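/- Let $0\le m\le q$, $0\le n\le p$ be integers. For real pairs $(a_i,A_i)_{i\le p}$, $(b_i,B_i)_{i\le q}$ with $A_i,B_i>0$ and for $x>0$, the Fox $H$-function is $$H^{m,n}_{p,q}\!\left(x\,\middle|\,\begin{matrix}(a_i,A_i)_{1:p}\\(b_i,B_i)_{1:q}\end{matrix}\right)=\frac1{2\pi j}\int_{c-j\infty}^{c+j\infty}\Theta(v)\,x^{-v}\,dv,\qquad \Theta(v)=\frac{\prod_{i=1}^m\Gamma(b_i+B_iv)\prod_{i=1}^n\Gamma(1-a_i-A_iv)}{\prod_{i=n+1}^p\Gamma(a_i+A_iv)\prod_{i=m+1}^q\Gamma(1-b_i-B_iv)},$$ where the contour $\operatorname{Re}v=c$ separates the poles of the $\Gamma(b_i+B_iv)$, $i\le m$ (to its left), from the poles of the $\Gamma(1-a_i-A_iv)$, $i\le n$ (to its right), and the integral converges absolutely. Let the SNR $\gamma_{id}$ of the ideal link be a positive random variable with probability density $$f(\gamma)=\sum_{\ell=1}^L\psi_\ell\,H^{m,n}_{p,q}\!\left(\phi_\ell\gamma\,\middle|\,\begin{matrix}(a^{(\ell)}_i,A^{(\ell)}_i)_{1:p}\\(b^{(\ell)}_i,B^{(\ell)}_i)_{1:q}\end{matrix}\right),\quad\gamma>0,$$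 with $\psi_\ell,\phi_\ell>0$, $A^{(\ell)}_i,B^{(\ell)}_i>0$, and an admissible contour for each $\ell$. For $\omega,\tau>0$, $\varrho\ge0$ let $F$ be the distribution function of the SINR $\omega/(\varrho+\tau/\gamma_{id})$, and let $\mathcal C=\frac1{\log 2}\int_0^{\omega/\varrho}\log(1+\gamma)\,F'(\gamma)\,d\gamma$ (with upper limit $\infty$ if $\varrho=0$) be the ergodic capacity under constant power with optimum rate adaptation. Then, for an ideal RF front end ($\omega=\tau=1$, $\varrho=0$), the capacity integral converges and $$\mathcal C^{(id)}=\frac1{\log2}\sum_{\ell=1}^L\frac{\psi_\ell}{\phi_\ell}\,H^{m+2,n+1}_{p+2,q+2}\!\left(\phi_\ell\,\middle|\,\begin{matrix}(0,1),\,(a_i^{(\ell)}+A_i^{(\ell)},A_i^{(\ell)})_{1:p},\,(1,1)\\(0,1),\,(0,1),\,(b_i^{(\ell)}+B_i^{(\ell)},B_i^{(\ell)})_{1:q}\end{matrix}\right)$$ for every choice of vertical contours that separate the poles of the kernels on the right; on every such contour the integral converges absolutely. Such contours exist whenever $b_i^{(\ell)}+B_i^{(\ell)}>0$ for $i\le m$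 and $a_i^{(\ell)}+A_i^{(\ell)}<1$ for $i\le n$ (for all $\ell$). -/

import Mathlib

open MeasureTheory

noncomputable section

namespace FoxHFading

/-- The Mellin--Barnes kernel of the univariate Fox function `H^{m,n}_{p,q}` with upper parameters
`up i = (a_i, A_i)` (for `i < p`) and lower parameters `lo i = (b_i, B_i)` (for `i < q`):
`∏_{i ≤ m} Γ(b_i + B_i v) ∏_{i ≤ n} Γ(1 - a_i - A_i v)` divided by
`∏_{n < i ≤ p} Γ(a_i + A_i v) ∏_{m < i ≤ q} Γ(1 - b_i - B_i v)`.
(`Complex.Gamma` is `0` at the poles of `Γ`, so that the denominator has the usual meaning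
`1 / Γ = 0` there.) -/
def foxKernel (m n : ℕ) {p q : ℕ} (up : Fin p → ℝ × ℝ) (lo : Fin q → ℝ × ℝ) (v : ℂ) : ℂ :=
  ((∏ i : Fin q with i.val < m, Complex.Gamma ((lo i).1 + (lo i).2 * v)) *
      ∏ i : Fin p with i.val < n, Complex.Gamma (1 - (up i).1 - (up i).2 * v)) /
    ((∏ i : Fin p with n ≤ i.val, Complex.Gamma ((up i).1 + (up i).2 * v)) *
      ∏ i : Fin q with m ≤ i.val, Complex.Gamma (1 - (lo i).1 - (lo i).2 * v))

/-- The vertical line `Re v = c` separates the poles `-(b_i + k) / B_i` of the factors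
`Γ(b_i + B_i v)`, `i ≤ m`, which lie to its left, from the poles `(1 - a_i + k) / A_i` of the
factors `Γ(1 - a_i - A_i v)`, `i ≤ n`, which lie to its right. -/
structure SeparatesPoles (m n : ℕ) {p q : ℕ} (up : Fin p → ℝ × ℝ) (lo : Fin q → ℝ × ℝ)
    (c : ℝ) : Prop where
  left : ∀ i : Fin q, i.val < m → ∀ k : ℕ, -((lo i).1 + k) / (lo i).2 < c
  right : ∀ i : Fin p, i.val < n → ∀ k : ℕ, c < (1 - (up i).1 + k) / (up i).2

/-- An admissible Mellin--Barnes contour: the line `Re v = c` separates the two sets of poles, and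
the Mellin--Barnes integral converges absolutely along it. (For `x > 0` the factor `x ^ (-v)` has
constant modulus on the line, so that convergence does not depend on `x`.) -/
structure IsFoxContour (m n : ℕ) {p q : ℕ} (up : Fin p → ℝ × ℝ) (lo : Fin q → ℝ × ℝ)
    (c : ℝ) : Prop where
  separates : SeparatesPoles m n up lo c
  converges : Complex.VerticalIntegrable (foxKernel m n up lo) c

/-- The univariate Fox function `H^{m,n}_{p,q}(x | up ; lo)`, `x > 0`, with contour `Re v = c`:
`(1 / (2 π j)) ∫_{c - j∞}^{c + j∞} foxKernel v * x ^ (-v) dv`. -/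
def foxH (m n : ℕ) {p q : ℕ} (up : Fin p → ℝ × ℝ) (lo : Fin q → ℝ × ℝ) (c x : ℝ) : ℂ :=
  mellinInv c (foxKernel m n up lo) x

/-- `(a, A) ↦ (a + A, A)`, applied to each member of a list of parameters. -/
def shiftParams {r : ℕ} (u : Fin r → ℝ × ℝ) : Fin r → ℝ × ℝ :=
  fun i => ((u i).1 + (u i).2, (u i).2)

/-- The list `(0,1), Ψ, (1,1)` where `Ψ` is the shifted list of upper parameters. -/
def capacityUpper {p : ℕ} (up : Fin p → ℝ × ℝ) : Fin (p + 2) → ℝ × ℝ :=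
  Fin.cons (α := fun _ => ℝ × ℝ) (0, 1)
    (Fin.snoc (α := fun _ => ℝ × ℝ) (shiftParams up) (1, 1))

/-- The list `(0,1), (0,1), Υ` where `Υ` is the shifted list of lower parameters. -/
def capacityLower {q : ℕ} (lo : Fin q → ℝ × ℝ) : Fin (q + 2) → ℝ × ℝ :=
  Fin.cons (α := fun _ => ℝ × ℝ) (0, 1)
    (Fin.cons (α := fun _ => ℝ × ℝ) (0, 1) (shiftParams lo))

/-- The end-to-end SINR `ω / (ϱ + τ / γ_id)` as a function of the SNR `γ_id` of the ideal link. -/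
def sinr (ω ϱ τ γid : ℝ) : ℝ := ω / (ϱ + τ / γid)

variable {Ω : Type*} [MeasurableSpace Ω]

/-- The cumulative distribution function of the SINR. -/
def sinrCDF (P : Measure Ω) (γid : Ω → ℝ) (ω ϱ τ : ℝ) (x : ℝ) : ℝ :=
  ProbabilityTheory.cdf (P.map fun w => sinr ω ϱ τ (γid w)) x

/-- The range `0 < γ < ω / ϱ` of the SINR, which is `0 < γ < ∞` for `ϱ = 0 < ω`. -/
def sinrRange (ω ϱ : ℝ) : Set ℝ := {x | 0 < x ∧ ϱ * x < ω}

/-- The integrand `log (1 + γ) * ∂F/∂γ` of the ergodic capacity. -/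
def capacityIntegrand (P : Measure Ω) (γid : Ω → ℝ) (ω ϱ τ : ℝ) (x : ℝ) : ℝ :=
  Real.log (1 + x) * deriv (sinrCDF P γid ω ϱ τ) x

/-- The ergodic capacity under constant power with optimum rate adaptation. -/
def oraCapacity (P : Measure Ω) (γid : Ω → ℝ) (ω ϱ τ : ℝ) : ℝ :=
  1 / Real.log 2 * ∫ x in sinrRange ω ϱ, capacityIntegrand P γid ω ϱ τ x

/-- `f` is a probability density function, carried by `(0, ∞)`, of the random variable `X`. -/
structure IsPositivePDF (P : Measure Ω) (X : Ω → ℝ) (f : ℝ → ℝ) : Prop where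
  aemeasurable : AEMeasurable X P
  nonneg : ∀ x, 0 < x → 0 ≤ f x
  map_eq : P.map X = (volume.restrict (Set.Ioi 0)).withDensity fun x => ENNReal.ofReal (f x)

end FoxHFading

end

/-! For `ω = τ = 1`, `ϱ = 0` the SINR is `γid` itself, so F' = f and the capacity is ∫₀^∞ log(1+x)
f(x) dx / log 2. For 0 < Re v < 1 the Mellin transform of log(1+x) at -v is Γ(v)Γ(1-v)/v. Parseval's
formula, with s = v + 1, formally turns each Fox function in f into the Mellin–Barnes integral of
φ^(-v-1) Γ(v)Γ(1-v)/v Θ(v+1). Since 1/v = Γ(v)/Γ(1+v), this is 1/φ times the claimed Fox function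
(`foxKernel_capacity_eq_mellin_mul`).

The difficulty is that Parseval's formula needs the given line Re s = c, the only one on which Θ is
assumed integrable, whereas log(1+x) has a Mellin transform only for 1 < Re s < 2, and c may lie
elsewhere. Hence log(1+x) is first replaced by `cutLog`, whose transform is holomorphic on a strip
as wide as desired and decays faster than any power on vertical lines: the Euler operator x d/dx
acts on transforms as multiplication by -s. This decay pays for moving the line from c to d + 1,
because Gamma factors on two vertical lines of a bounded strip differ by at most powers of |t|, so Θ
stays below (1+|t|)^N E(t) with E integrable (`IsFoxContour.exists_norm_le`,
`integral_vertical_eq`).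

Finally the cut-off is removed. The bounds on the transforms are uniform in it
(`eulerBounded_cutLog`), so dominated convergence applies on the Mellin–Barnes side, and the same
bounds give absolute convergence on the line Re v = d. The cut-offs increase to log(1+x) and f ≥ 0,
so monotone convergence gives both the finiteness and the value of the capacity integral. -/

namespace FoxHFading

open Filter Topology Set

/-! ### Growth of Gamma factors and Mellin–Barnes kernels on vertical lines -/

/-- `‖Γ(σ + i t)‖ / Γ(σ)` increases with `σ > 0`. -/
theorem norm_Gamma_mul_le {a b : ℝ} (ha : 0 < a) (hab : a ≤ b) (t : ℝ) :
    ‖Complex.Gamma (a + t * Complex.I)‖ * Real.Gamma b ≤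
      Real.Gamma a * ‖Complex.Gamma (b + t * Complex.I)‖ := by
  have hb : 0 < b := ha.trans_le hab
  -- Euler's limit formula reduces the claim to its n-th approximants, where n ^ a * n ^ b and the
  -- factorials agree on both sides.
  refine le_of_tendsto_of_tendsto
    ((Complex.GammaSeq_tendsto_Gamma (a + t * Complex.I)).norm.mul
      (Real.GammaSeq_tendsto_Gamma b))
    ((Real.GammaSeq_tendsto_Gamma a).mul
      (Complex.GammaSeq_tendsto_Gamma (b + t * Complex.I)).norm) ?_
  filter_upwards [eventually_gt_atTop 0] with n hn
  have hn' : (0 : ℝ) < n := by exact_mod_cast hn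
  have key : ∀ c : ℝ, 0 < c → ‖Complex.GammaSeq (c + t * Complex.I) n‖ =
      (n : ℝ) ^ c * n.factorial / ∏ j ∈ Finset.range (n + 1), ‖(c + j + t * Complex.I : ℂ)‖ := by
    intro c hc
    rw [Complex.GammaSeq, norm_div, norm_mul, norm_prod, Complex.norm_natCast]
    congr 2
    · rw [← Complex.ofReal_natCast, Complex.norm_cpow_eq_rpow_re_of_pos hn']
      simp
    · funext j; rw [add_right_comm]
  rw [key a ha, key b hb, Real.GammaSeq, Real.GammaSeq]
  have hpos : ∀ c : ℝ, 0 < c → ∀ j : ℕ, 0 < ‖(c + j + t * Complex.I : ℂ)‖ := by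
    intro c hc j
    rw [norm_pos_iff]
    intro h
    have := congrArg Complex.re h
    simp at this
    have : (0 : ℝ) ≤ j := Nat.cast_nonneg j
    linarith
  have h1 : ∀ c : ℝ, 0 < c → 0 < ∏ j ∈ Finset.range (n + 1), ‖(c + j + t * Complex.I : ℂ)‖ :=
    fun c hc => Finset.prod_pos fun j _ => hpos c hc j
  have h2 : ∀ c : ℝ, 0 < c → 0 < ∏ j ∈ Finset.range (n + 1), (c + j) :=
    fun c hc => Finset.prod_pos fun j _ => by positivity
  rw [div_mul_div_comm, div_mul_div_comm, ← Finset.prod_mul_distrib, ← Finset.prod_mul_distrib]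
  -- Squared, each factor reads (a+j)²((b+j)²+t²) ≤ ((a+j)²+t²)(b+j)², that is, (a+j)² t² ≤ (b+j)²
  -- t².
  have h3 : ∏ j ∈ Finset.range (n + 1), ((a + j) * ‖(b + j + t * Complex.I : ℂ)‖) ≤
      ∏ j ∈ Finset.range (n + 1), (‖(a + j + t * Complex.I : ℂ)‖ * (b + j)) := by
    refine Finset.prod_le_prod (fun j _ => by positivity) fun j _ => ?_
    have hna : ∀ c : ℝ, ‖(c + j + t * Complex.I : ℂ)‖ ^ 2 = (c + j) ^ 2 + t ^ 2 := by
      intro c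
      rw [← Complex.normSq_eq_norm_sq, Complex.normSq_apply]
      simp; ring
    refine le_of_sq_le_sq ?_ (by positivity)
    rw [mul_pow, mul_pow, hna, hna]
    have : (a + j) ^ 2 ≤ (b + j) ^ 2 := by gcongr
    nlinarith [sq_nonneg t]
  have h4 : 0 < ∏ j ∈ Finset.range (n + 1), ((a + j) * ‖(b + j + t * Complex.I : ℂ)‖) :=
    Finset.prod_pos fun j _ => mul_pos (by positivity) (hpos b hb j)
  exact div_le_div₀ (by positivity) (le_of_eq (by ring)) h4 h3

theorem Gamma_add_natCast_eq_prod_mul (z : ℂ) (hz : z.im ≠ 0) (M : ℕ) :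
    Complex.Gamma (z + M) = (∏ k ∈ Finset.range M, (z + k)) * Complex.Gamma z := by
  induction M with
  | zero => simp
  | succ M ih =>
    rw [Finset.prod_range_succ, mul_right_comm, ← ih, Nat.cast_succ, ← add_assoc,
      Complex.Gamma_add_one, mul_comm]
    intro h
    apply hz
    simpa using congrArg Complex.im h

/-- On vertical lines in a bounded strip, `Γ` is comparable up to powers of the imaginary part. -/
theorem exists_norm_Gamma_le {δ : ℝ} (hδ : 0 < δ) (R : ℝ) : ∃ (C : ℝ) (N : ℕ), 0 ≤ C ∧
    ∀ a b t : ℝ, |a| ≤ R → |b| ≤ R → δ ≤ |t| →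
      ‖Complex.Gamma (a + t * Complex.I)‖ ≤
        C * (1 + |t|) ^ N * ‖Complex.Gamma (b + t * Complex.I)‖ := by
  -- This M gives 1 ≤ a + M ≤ b + 2M ≤ 3M for all |a|, |b| ≤ R, so monotonicity in the real part
  -- applies after shifting by M and 2M.
  obtain ⟨M, hM⟩ := exists_nat_gt (2 * R + 1)
  have hcont : ContinuousOn Real.Gamma (Icc 1 (3 * M)) := fun x hx =>
    (Real.differentiableAt_Gamma fun m => by
      have : (0 : ℝ) ≤ m := Nat.cast_nonneg m
      have := hx.1
      linarith).continuousAt.continuousWithinAt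
  obtain ⟨C₁, hC₁⟩ := isCompact_Icc.exists_bound_of_continuousOn hcont
  have hcont' : ContinuousOn (fun x => (Real.Gamma x)⁻¹) (Icc 1 (3 * M)) := hcont.inv₀ fun x hx =>
    (Real.Gamma_pos_of_pos (by linarith [hx.1])).ne'
  obtain ⟨C₂, hC₂⟩ := isCompact_Icc.exists_bound_of_continuousOn hcont'
  refine ⟨δ⁻¹ ^ M * (|C₁| * |C₂| * (1 + 3 * M) ^ (2 * M)), 2 * M, by positivity, ?_⟩
  intro a b t ha hb ht
  have hR : 0 ≤ R := (abs_nonneg a).trans ha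
  obtain ⟨ha1, ha2⟩ := abs_le.1 ha
  obtain ⟨hb1, hb2⟩ := abs_le.1 hb
  have ht0 : t ≠ 0 := by
    rintro rfl
    simp at ht
    linarith
  have him : ∀ c : ℝ, ((c : ℂ) + t * Complex.I).im ≠ 0 := fun c => by simpa using ht0
  have eA := Gamma_add_natCast_eq_prod_mul (a + t * Complex.I) (him a) M
  have eB := Gamma_add_natCast_eq_prod_mul (b + t * Complex.I) (him b) (2 * M)
  have hA : (a : ℂ) + t * Complex.I + M = ((a + M : ℝ) : ℂ) + t * Complex.I := by
    push_cast; ring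
  have hB : (b : ℂ) + t * Complex.I + (2 * M : ℕ) = ((b + 2 * M : ℝ) : ℂ) + t * Complex.I := by
    push_cast; ring
  rw [hA] at eA
  rw [hB] at eB
  have hmono := norm_Gamma_mul_le (a := a + M) (b := b + 2 * M) (by linarith) (by linarith) t
  have ha' : a + M ∈ Icc (1 : ℝ) (3 * M) := ⟨by linarith, by linarith⟩
  have hb' : b + 2 * M ∈ Icc (1 : ℝ) (3 * M) := ⟨by linarith, by linarith⟩
  have hΓb : 0 < Real.Gamma (b + 2 * M) := Real.Gamma_pos_of_pos (by linarith)
  have h1 : Real.Gamma (a + M) ≤ |C₁| := (le_abs_self _).trans ((hC₁ _ ha').trans (le_abs_self _))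
  have h2 : (Real.Gamma (b + 2 * M))⁻¹ ≤ |C₂| :=
    (le_abs_self _).trans ((hC₂ _ hb').trans (le_abs_self _))
  have h3 : ‖Complex.Gamma ((a + M : ℝ) + t * Complex.I)‖ ≤
      |C₁| * |C₂| * ‖Complex.Gamma ((b + 2 * M : ℝ) + t * Complex.I)‖ := by
    rw [← le_div_iff₀ hΓb] at hmono
    refine hmono.trans ?_
    rw [div_eq_mul_inv, mul_right_comm]
    gcongr
  -- Every factor of the functional equation has modulus at least |t| ≥ δ; upper bounds on the
  -- factors for b produce the power of 1 + |t|.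
  have h4 : δ ^ M * ‖Complex.Gamma (a + t * Complex.I)‖ ≤
      ‖Complex.Gamma ((a + M : ℝ) + t * Complex.I)‖ := by
    rw [eA, norm_mul, norm_prod]
    gcongr
    calc δ ^ M = ∏ k ∈ Finset.range M, δ := by simp
      _ ≤ _ := Finset.prod_le_prod (fun _ _ => hδ.le) fun k _ => ?_
    refine ht.trans ?_
    have := Complex.abs_im_le_norm ((a : ℂ) + t * Complex.I + k)
    simpa using this
  have h5 : ‖Complex.Gamma ((b + 2 * M : ℝ) + t * Complex.I)‖ ≤
      ((1 + 3 * M) * (1 + |t|)) ^ (2 * M) * ‖Complex.Gamma (b + t * Complex.I)‖ := by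
    rw [eB, norm_mul, norm_prod]
    gcongr
    calc _ ≤ ∏ k ∈ Finset.range (2 * M), ((1 + 3 * M) * (1 + |t|)) :=
          Finset.prod_le_prod (fun _ _ => norm_nonneg _) fun k hk => ?_
      _ = _ := by simp
    have hk' : (k : ℝ) ≤ 2 * M := by
      have := (Finset.mem_range.1 hk).le
      exact_mod_cast this
    calc ‖(b : ℂ) + t * Complex.I + k‖ ≤ ‖(b : ℂ)‖ + ‖(t : ℂ) * Complex.I‖ + ‖(k : ℂ)‖ :=
          norm_add₃_le
      _ = |b| + |t| + k := by simp
      _ ≤ (1 + 3 * M) * (1 + |t|) := by nlinarith [abs_nonneg t]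
  have h6 : ‖Complex.Gamma (a + t * Complex.I)‖ =
      δ⁻¹ ^ M * (δ ^ M * ‖Complex.Gamma (a + t * Complex.I)‖) := by
    rw [← mul_assoc, ← mul_pow, inv_mul_cancel₀ hδ.ne', one_pow, one_mul]
  rw [h6]
  calc _ ≤ δ⁻¹ ^ M * (|C₁| * |C₂| * (((1 + 3 * M) * (1 + |t|)) ^ (2 * M) *
        ‖Complex.Gamma (b + t * Complex.I)‖)) := by
        refine mul_le_mul_of_nonneg_left ?_ (by positivity)
        exact h4.trans (h3.trans (by gcongr))
    _ = _ := by rw [mul_pow]; ring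

/-- The moduli of `F` on vertical lines in a bounded strip are comparable up to powers of the
imaginary part. -/
def VerticallyComparable (F : ℂ → ℂ) : Prop :=
  ∀ R : ℝ, ∃ (C : ℝ) (N : ℕ), 0 ≤ C ∧ ∀ a b t : ℝ, |a| ≤ R → |b| ≤ R → 1 ≤ |t| →
    ‖F (a + t * Complex.I)‖ ≤ C * (1 + |t|) ^ N * ‖F (b + t * Complex.I)‖

namespace VerticallyComparable

theorem one : VerticallyComparable fun _ => 1 := fun _ =>
  ⟨1, 0, zero_le_one, fun a b t _ _ _ => by simp⟩

theorem mul {F G : ℂ → ℂ} (hF : VerticallyComparable F) (hG : VerticallyComparable G) :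
    VerticallyComparable fun v => F v * G v := by
  intro R
  obtain ⟨C, N, hC, h⟩ := hF R
  obtain ⟨C', N', hC', h'⟩ := hG R
  refine ⟨C * C', N + N', by positivity, fun a b t ha hb ht => ?_⟩
  simp only [norm_mul]
  calc _ ≤ (C * (1 + |t|) ^ N * ‖F (b + t * Complex.I)‖) *
        (C' * (1 + |t|) ^ N' * ‖G (b + t * Complex.I)‖) := by
        gcongr
        · exact h a b t ha hb ht
        · exact h' a b t ha hb ht
    _ = _ := by ring

/-- The condition is symmetric in the two lines, so exchanging them inverts the estimate; it also
forces zeros to occur at the same heights on both, which makes the convention 0⁻¹ = 0 harmless. -/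
theorem inv {F : ℂ → ℂ} (hF : VerticallyComparable F) : VerticallyComparable fun v => (F v)⁻¹ := by
  intro R
  obtain ⟨C, N, hC, h⟩ := hF R
  refine ⟨C, N, hC, fun a b t ha hb ht => ?_⟩
  simp only [norm_inv]
  have h1 := h a b t ha hb ht
  have h2 := h b a t hb ha ht
  rcases (norm_nonneg (F (a + t * Complex.I))).eq_or_lt with h0 | h0
  · rw [← h0, inv_zero]; positivity
  rcases (norm_nonneg (F (b + t * Complex.I))).eq_or_lt with h0' | h0'
  · rw [← h0', mul_zero] at h1; linarith
  rw [← div_eq_mul_inv, le_div_iff₀ h0', mul_comm, ← div_eq_mul_inv, div_le_iff₀ h0]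
  exact h2

theorem prod {ι : Type*} (s : Finset ι) {F : ι → ℂ → ℂ} (hF : ∀ i ∈ s, VerticallyComparable (F i)) :
    VerticallyComparable fun v => ∏ i ∈ s, F i v := by
  classical
  induction s using Finset.induction_on with
  | empty => simpa using one
  | insert i s hi ih =>
    simp only [Finset.prod_insert hi]
    exact (hF i (Finset.mem_insert_self i s)).mul
      (ih fun j hj => hF j (Finset.mem_insert_of_mem hj))

theorem Gamma_affine (α β : ℝ) (hβ : β ≠ 0) :
    VerticallyComparable fun v => Complex.Gamma (α + β * v) := by
  intro R
  obtain ⟨C, N, hC, h⟩ := exists_norm_Gamma_le (abs_pos.2 hβ) (|α| + |β| * R)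
  refine ⟨C * (1 + |β|) ^ N, N, by positivity, fun a b t ha hb ht => ?_⟩
  have e : ∀ c : ℝ, (α + β * (c + t * Complex.I) : ℂ) =
      ((α + β * c : ℝ) : ℂ) + ((β * t : ℝ) : ℂ) * Complex.I := by
    intro c; push_cast; ring
  have hle : ∀ c : ℝ, |c| ≤ R → |α + β * c| ≤ |α| + |β| * R := fun c hc =>
    (abs_add_le _ _).trans (by rw [abs_mul]; gcongr)
  simp only [e]
  refine (h _ _ (β * t) (hle a ha) (hle b hb) ?_).trans ?_
  · rw [abs_mul]; exact le_mul_of_one_le_right (abs_nonneg _) ht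
  · rw [mul_assoc C ((1 + |β|) ^ N), ← mul_pow]
    gcongr
    rw [abs_mul]
    nlinarith [abs_nonneg β, abs_nonneg t]

end VerticallyComparable

theorem verticallyComparable_foxKernel (m n : ℕ) {p q : ℕ} (up : Fin p → ℝ × ℝ)
    (lo : Fin q → ℝ × ℝ) (hA : ∀ i, 0 < (up i).2) (hB : ∀ i, 0 < (lo i).2) :
    VerticallyComparable (foxKernel m n up lo) := by
  have hsub : ∀ a A : ℝ, 0 < A → VerticallyComparable fun v => Complex.Gamma (1 - a - A * v) := by
    intro a A h
    have := VerticallyComparable.Gamma_affine (1 - a) (-A) (by linarith)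
    simpa [sub_eq_add_neg] using this
  have hadd : ∀ a A : ℝ, 0 < A → VerticallyComparable fun v => Complex.Gamma (a + A * v) :=
    fun a A h => VerticallyComparable.Gamma_affine a A h.ne'
  unfold foxKernel
  simp only [div_eq_mul_inv]
  refine .mul (.mul (.prod _ fun i _ => hadd _ _ (hB i)) (.prod _ fun i _ => hsub _ _ (hA i)))
    (.inv (.mul (.prod _ fun i _ => hadd _ _ (hA i)) (.prod _ fun i _ => hsub _ _ (hB i))))

theorem differentiableAt_Gamma_of_re {z : ℂ} (h : ∀ k : ℕ, z.re ≠ -k) :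
    DifferentiableAt ℂ Complex.Gamma z :=
  Complex.differentiableAt_Gamma z fun k hk => h k (by simp [hk])

/-- Since 1/Γ is entire, only the Gamma factors of the numerator can produce singularities, and the
separation of the poles excludes these. -/
theorem SeparatesPoles.differentiableAt {m n p q : ℕ} {up : Fin p → ℝ × ℝ}
    {lo : Fin q → ℝ × ℝ} (hA : ∀ i, 0 < (up i).2) (hB : ∀ i, 0 < (lo i).2) {v : ℂ}
    (h : SeparatesPoles m n up lo v.re) : DifferentiableAt ℂ (foxKernel m n up lo) v := by
  have hinv : ∀ g : ℂ → ℂ, DifferentiableAt ℂ g v →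
      DifferentiableAt ℂ (fun v => (Complex.Gamma (g v))⁻¹) v := fun g hg =>
    (Complex.differentiable_one_div_Gamma (g v)).fun_comp' v hg
  unfold foxKernel
  simp only [div_eq_mul_inv, mul_inv, ← Finset.prod_inv_distrib]
  refine .mul (.mul (.fun_finsetProd fun i hi => ?_) (.fun_finsetProd fun i hi => ?_))
    (.mul (.fun_finsetProd fun i _ => hinv _ (by fun_prop))
      (.fun_finsetProd fun i _ => hinv _ (by fun_prop)))
  · refine (differentiableAt_Gamma_of_re fun k hk => ?_).fun_comp' v (by fun_prop)
    have := h.left i (Finset.mem_filter.1 hi).2 k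
    rw [div_lt_iff₀ (hB i)] at this
    simp at hk
    linarith
  · refine (differentiableAt_Gamma_of_re fun k hk => ?_).fun_comp' v (by fun_prop)
    have := h.right i (Finset.mem_filter.1 hi).2 k
    rw [lt_div_iff₀ (hA i)] at this
    simp at hk
    linarith

theorem SeparatesPoles.of_mem_uIcc {m n p q : ℕ} {up : Fin p → ℝ × ℝ} {lo : Fin q → ℝ × ℝ}
    {a b c : ℝ} (ha : SeparatesPoles m n up lo a) (hb : SeparatesPoles m n up lo b)
    (hc : c ∈ uIcc a b) : SeparatesPoles m n up lo c where
  left i hi k := (lt_min (ha.left i hi k) (hb.left i hi k)).trans_le hc.1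
  right i hi k := hc.2.trans_lt (max_lt (ha.right i hi k) (hb.right i hi k))

/-- Growth of the kernel in the strip between an admissible contour and any other line separating
the poles. -/
theorem IsFoxContour.exists_norm_le {m n p q : ℕ} {up : Fin p → ℝ × ℝ} {lo : Fin q → ℝ × ℝ}
    (hA : ∀ i, 0 < (up i).2) (hB : ∀ i, 0 < (lo i).2) {a b : ℝ}
    (ha : IsFoxContour m n up lo a) (hb : SeparatesPoles m n up lo b) :
    ∃ (E : ℝ → ℝ) (N : ℕ), Integrable E ∧ (∀ t, 0 ≤ E t) ∧ ∀ c ∈ uIcc a b, ∀ t : ℝ,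
      ‖foxKernel m n up lo (c + t * Complex.I)‖ ≤ (1 + |t|) ^ N * E t := by
  obtain ⟨C, N, hC, h⟩ := verticallyComparable_foxKernel m n up lo hA hB (max |a| |b|)
  have hcomp : IsCompact (uIcc a b ×ˢ Icc (-1 : ℝ) 1) := isCompact_uIcc.prod isCompact_Icc
  have hcont : ContinuousOn (fun x : ℝ × ℝ => foxKernel m n up lo (x.1 + x.2 * Complex.I))
      (uIcc a b ×ˢ Icc (-1 : ℝ) 1) := by
    intro x hx
    have hd : SeparatesPoles m n up lo ((x.1 : ℂ) + x.2 * Complex.I).re := by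
      simpa using ha.separates.of_mem_uIcc hb hx.1
    have := (hd.differentiableAt hA hB).continuousAt
    exact (ContinuousAt.comp (f := fun x : ℝ × ℝ => ((x.1 : ℂ) + x.2 * Complex.I)) this
      (by fun_prop)).continuousWithinAt
  obtain ⟨K, hK⟩ := hcomp.exists_bound_of_continuousOn hcont
  -- For |t| ≥ 1 the comparison with the line a suffices. For |t| ≤ 1 the kernel is bounded by
  -- compactness, and 2 / (1 + t²) ≥ 1 there makes the second term dominate.
  refine ⟨fun t => C * ‖foxKernel m n up lo (a + t * Complex.I)‖ + 2 * |K| * (1 + t ^ 2)⁻¹, N,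
    (ha.converges.norm.const_mul C).add (integrable_inv_one_add_sq.const_mul _),
    fun t => by positivity, fun c hc t => ?_⟩
  have hca : |c| ≤ max |a| |b| := by
    rcases le_total a b with hab | hab
    · rw [uIcc_of_le hab] at hc
      exact abs_le_max_abs_abs hc.1 hc.2
    · rw [uIcc_of_ge hab] at hc
      rw [max_comm]
      exact abs_le_max_abs_abs hc.1 hc.2
  have h1 : (1 : ℝ) ≤ (1 + |t|) ^ N := one_le_pow₀ (by linarith [abs_nonneg t])
  rcases le_total 1 |t| with ht | ht
  · calc _ ≤ C * (1 + |t|) ^ N * ‖foxKernel m n up lo (a + t * Complex.I)‖ :=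
          h c a t hca (le_max_left _ _) ht
      _ ≤ C * (1 + |t|) ^ N * ‖foxKernel m n up lo (a + t * Complex.I)‖ +
          (1 + |t|) ^ N * (2 * |K| * (1 + t ^ 2)⁻¹) := le_add_of_nonneg_right (by positivity)
      _ = _ := by ring
  · have h2 : ‖foxKernel m n up lo (c + t * Complex.I)‖ ≤ |K| :=
      (hK (c, t) ⟨hc, abs_le.1 ht⟩).trans (le_abs_self K)
    have h3 : (1 : ℝ) ≤ 2 * (1 + t ^ 2)⁻¹ := by
      rw [← div_eq_mul_inv, le_div_iff₀ (by positivity)]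
      have : t ^ 2 ≤ 1 := by rw [← sq_abs]; exact pow_le_one₀ (abs_nonneg t) ht
      linarith
    calc _ ≤ |K| := h2
      _ ≤ |K| * (2 * (1 + t ^ 2)⁻¹) := le_mul_of_one_le_right (abs_nonneg K) h3
      _ ≤ C * ‖foxKernel m n up lo (a + t * Complex.I)‖ + 2 * |K| * (1 + t ^ 2)⁻¹ := by
        have : 0 ≤ C * ‖foxKernel m n up lo (a + t * Complex.I)‖ := by positivity
        linarith
      _ ≤ _ := le_mul_of_one_le_left (by positivity) h1

/-! ### Shifting the line of integration -/

/-- An integrable function need not tend to 0, but arbitrarily large good heights ±T exist, and they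
suffice for the horizontal sides of the rectangles. -/
theorem frequently_add_neg_le_one {E : ℝ → ℝ} (hE : Integrable E) :
    ∃ᶠ T in atTop, E T + E (-T) ≤ 1 := by
  intro h
  simp only [not_le] at h
  obtain ⟨T₀, hT₀⟩ := eventually_atTop.1 h
  have hG : Integrable fun T => E T + E (-T) := hE.add hE.comp_neg
  have hfin := hG.measure_norm_ge_lt_top one_pos
  have hle : volume (Ici T₀) ≤ volume {T | 1 ≤ ‖E T + E (-T)‖} :=
    measure_mono fun T hT => (hT₀ T hT).le.trans (le_abs_self _)
  rw [Real.volume_Ici] at hle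
  exact (hle.trans_lt hfin).ne rfl

/-- Shift of a vertical line of integration. -/
theorem integral_vertical_eq {F : ℂ → ℂ} {a b : ℝ} {E : ℝ → ℝ} (hE : Integrable E)
    (hE0 : ∀ t, 0 ≤ E t) (hF : ∀ v : ℂ, v.re ∈ uIcc a b → DifferentiableAt ℂ F v)
    (hb : ∀ c ∈ uIcc a b, ∀ t : ℝ, ‖F (c + t * Complex.I)‖ ≤ (1 + |t|)⁻¹ * E t) :
    (∀ c ∈ uIcc a b, Integrable fun t : ℝ => F (c + t * Complex.I)) ∧
    ∫ t : ℝ, F (a + t * Complex.I) = ∫ t : ℝ, F (b + t * Complex.I) := by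
  have hint : ∀ c ∈ uIcc a b, Integrable fun t : ℝ => F (c + t * Complex.I) := by
    intro c hc
    refine hE.mono' (Continuous.aestronglyMeasurable ?_) (ae_of_all _ fun t => ?_)
    · rw [continuous_iff_continuousAt]
      intro t
      exact ContinuousAt.comp (f := fun t : ℝ => (c : ℂ) + t * Complex.I)
        (hF _ (by simpa using hc)).continuousAt (by fun_prop)
    · refine (hb c hc t).trans (mul_le_of_le_one_left (hE0 t) (inv_le_one_of_one_le₀ ?_))
      linarith [abs_nonneg t]
  refine ⟨hint, ?_⟩
  have ha' := hint a left_mem_uIcc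
  have hb' := hint b right_mem_uIcc
  have hlim : Tendsto (fun T : ℝ => ‖(∫ t in (-T)..T, F (b + t * Complex.I)) -
      ∫ t in (-T)..T, F (a + t * Complex.I)‖) atTop
      (𝓝 ‖(∫ t : ℝ, F (b + t * Complex.I)) - ∫ t : ℝ, F (a + t * Complex.I)‖) :=
    ((intervalIntegral_tendsto_integral hb' tendsto_neg_atTop_atBot tendsto_id).sub
      (intervalIntegral_tendsto_integral ha' tendsto_neg_atTop_atBot tendsto_id)).norm
  have hbound : ∀ T : ℝ, 0 ≤ T → ‖(∫ t in (-T)..T, F (b + t * Complex.I)) -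
      ∫ t in (-T)..T, F (a + t * Complex.I)‖ ≤ (1 + T)⁻¹ * |b - a| * (E T + E (-T)) := by
    intro T hT
    have hrect := Complex.integral_boundary_rect_eq_zero_of_differentiableOn F
      (a + (-T : ℝ) * Complex.I) (b + T * Complex.I) (fun v hv => by
        have := (Complex.mem_reProdIm.1 hv).1
        exact (hF v (by simpa using this)).differentiableWithinAt)
    simp only [Complex.add_re, Complex.ofReal_re, Complex.mul_re, Complex.I_re, mul_zero,
      Complex.ofReal_im, Complex.I_im, mul_one, sub_self, add_zero, Complex.add_im,
      Complex.mul_im, zero_add] at hrect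
    have hhor : ∀ s : ℝ, |s| = T → ‖∫ x in a..b, F (x + s * Complex.I)‖ ≤
        (1 + T)⁻¹ * E s * |b - a| := by
      intro s hs
      refine intervalIntegral.norm_integral_le_of_norm_le_const fun x hx => ?_
      rw [← hs]
      exact hb x (uIoc_subset_uIcc hx) s
    have h1 := hhor T (abs_of_nonneg hT)
    have h2 := hhor (-T) (by rw [abs_neg, abs_of_nonneg hT])
    set V₁ := ∫ t in (-T)..T, F (a + t * Complex.I)
    set V₂ := ∫ t in (-T)..T, F (b + t * Complex.I)
    set H₁ := ∫ x in a..b, F (x + (-T : ℝ) * Complex.I)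
    set H₂ := ∫ x in a..b, F (x + T * Complex.I)
    have h3 : Complex.I * (V₂ - V₁) = H₂ - H₁ := by
      simp only [smul_eq_mul] at hrect
      linear_combination hrect
    have h4 : ‖V₂ - V₁‖ = ‖H₂ - H₁‖ := by rw [← h3, norm_mul, Complex.norm_I, one_mul]
    rw [h4]
    calc _ ≤ ‖H₂‖ + ‖H₁‖ := norm_sub_le _ _
      _ ≤ (1 + T)⁻¹ * E T * |b - a| + (1 + T)⁻¹ * E (-T) * |b - a| := add_le_add h1 h2
      _ = _ := by ring
  have hz : Tendsto (fun T : ℝ => (1 + T)⁻¹ * |b - a|) atTop (𝓝 0) := by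
    simpa using ((tendsto_const_nhds (x := (1 : ℝ))).add_atTop tendsto_id).inv_tendsto_atTop.mul_const
      |b - a|
  have hle : ‖(∫ t : ℝ, F (b + t * Complex.I)) - ∫ t : ℝ, F (a + t * Complex.I)‖ ≤ 0 := by
    -- The difference of the two truncated integrals is bounded by (1+T)⁻¹ |b-a| for arbitrarily
    -- large T only; as its limit is known to exist, this makes it 0.
    refine le_of_tendsto_of_frequently (hlim.sub hz |>.trans (by rw [sub_zero])) ?_
    refine ((frequently_add_neg_le_one hE).and_eventually (eventually_ge_atTop 0)).mono ?_
    rintro T ⟨hT1, hT0⟩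
    have := hbound T hT0
    have h' : (1 + T)⁻¹ * |b - a| * (E T + E (-T)) ≤ (1 + T)⁻¹ * |b - a| :=
      mul_le_of_le_one_right (by positivity) hT1
    linarith
  exact (sub_eq_zero.1 (norm_le_zero_iff.1 hle)).symm

/-! ### Uniform bounds under the Euler operator x d/dx -/

/-- The functions `g i` on `(0, ∞)` and their first `j` images under the Euler operator `x d/dx`
are bounded by constant multiples of `W i`, uniformly in `i`. -/
def EulerBounded {ι : Type*} (W : ι → ℝ → ℝ) : ℕ → (ι → ℝ → ℝ) → Prop
  | 0, g => ∃ C : ℝ, 0 ≤ C ∧ ∀ i, ∀ x, 0 < x → |g i x| ≤ C * W i x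
  | j + 1, g => (∃ C : ℝ, 0 ≤ C ∧ ∀ i, ∀ x, 0 < x → |g i x| ≤ C * W i x) ∧
      ∃ g' : ι → ℝ → ℝ, (∀ i, ∀ x, 0 < x → HasDerivAt (g i) (g' i x / x) x) ∧
        EulerBounded W j g'

namespace EulerBounded

variable {ι : Type*} {W V : ι → ℝ → ℝ}

theorem bound {j : ℕ} {g : ι → ℝ → ℝ} (h : EulerBounded W j g) :
    ∃ C : ℝ, 0 ≤ C ∧ ∀ i, ∀ x, 0 < x → |g i x| ≤ C * W i x := by
  cases j with
  | zero => exact h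
  | succ j => exact h.1

theorem of_succ {j : ℕ} {g : ι → ℝ → ℝ} (h : EulerBounded W (j + 1) g) : EulerBounded W j g := by
  induction j generalizing g with
  | zero => exact h.1
  | succ j ih =>
    obtain ⟨h1, g', h2, h3⟩ := h
    exact ⟨h1, g', h2, ih h3⟩

theorem mono (hWV : ∀ i, ∀ x, 0 < x → W i x ≤ V i x) {j : ℕ} {g : ι → ℝ → ℝ}
    (h : EulerBounded W j g) : EulerBounded V j g := by
  have key : ∀ g : ι → ℝ → ℝ, (∃ C : ℝ, 0 ≤ C ∧ ∀ i, ∀ x, 0 < x → |g i x| ≤ C * W i x) →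
      ∃ C : ℝ, 0 ≤ C ∧ ∀ i, ∀ x, 0 < x → |g i x| ≤ C * V i x := by
    rintro g ⟨C, hC, hg⟩
    exact ⟨C, hC, fun i x hx =>
      (hg i x hx).trans (mul_le_mul_of_nonneg_left (hWV i x hx) hC)⟩
  induction j generalizing g with
  | zero => exact key g h
  | succ j ih => exact ⟨key g h.1, h.2.imp fun g' hg' => ⟨hg'.1, ih hg'.2⟩⟩

theorem add {j : ℕ} {g h : ι → ℝ → ℝ} (hg : EulerBounded W j g) (hh : EulerBounded W j h) :
    EulerBounded W j fun i x => g i x + h i x := by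
  have key : ∃ C : ℝ, 0 ≤ C ∧ ∀ i, ∀ x, 0 < x → |g i x + h i x| ≤ C * W i x := by
    obtain ⟨C, hC, h1⟩ := hg.bound
    obtain ⟨D, hD, h2⟩ := hh.bound
    exact ⟨C + D, by positivity, fun i x hx =>
      (abs_add_le _ _).trans (by linarith [h1 i x hx, h2 i x hx])⟩
  induction j generalizing g h with
  | zero => exact key
  | succ j ih =>
    obtain ⟨hg1, g', hg2, hg3⟩ := hg
    obtain ⟨hh1, h', hh2, hh3⟩ := hh
    refine ⟨key, fun i x => g' i x + h' i x, fun i x hx => ?_, ih hg3 hh3 ?_⟩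
    · convert! (hg2 i x hx).add (hh2 i x hx) using 1
      ring
    · obtain ⟨C, hC, h1⟩ := hg3.bound
      obtain ⟨D, hD, h2⟩ := hh3.bound
      exact ⟨C + D, by positivity, fun i x hx =>
        (abs_add_le _ _).trans (by linarith [h1 i x hx, h2 i x hx])⟩

theorem mul {j : ℕ} {g h : ι → ℝ → ℝ} (hg : EulerBounded W j g) (hh : EulerBounded V j h) :
    EulerBounded (fun i x => W i x * V i x) j fun i x => g i x * h i x := by
  have key : ∀ {g h : ι → ℝ → ℝ} {j : ℕ}, EulerBounded W j g → EulerBounded V j h →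
      ∃ C : ℝ, 0 ≤ C ∧ ∀ i, ∀ x, 0 < x → |g i x * h i x| ≤ C * (W i x * V i x) := by
    intro g h j hg hh
    obtain ⟨C, hC, h1⟩ := hg.bound
    obtain ⟨D, hD, h2⟩ := hh.bound
    refine ⟨C * D, by positivity, fun i x hx => ?_⟩
    rw [abs_mul]
    calc |g i x| * |h i x| ≤ (C * W i x) * (D * V i x) :=
          mul_le_mul (h1 i x hx) (h2 i x hx) (abs_nonneg _) ((abs_nonneg _).trans (h1 i x hx))
      _ = _ := by ring
  induction j generalizing g h with
  | zero => exact key (j := 0) hg hh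
  | succ j ih =>
    have hg0 := hg.of_succ
    have hh0 := hh.of_succ
    refine ⟨key hg hh, ?_⟩
    obtain ⟨hg1, g', hg2, hg3⟩ := hg
    obtain ⟨hh1, h', hh2, hh3⟩ := hh
    refine ⟨fun i x => g' i x * h i x + g i x * h' i x, fun i x hx => ?_,
      (ih hg3 hh0).add (ih hg0 hh3)⟩
    convert! (hg2 i x hx).mul (hh2 i x hx) using 1
    ring

theorem const (c : ℝ) (j : ℕ) : EulerBounded (fun (_ : ι) _ => 1) j fun _ _ => c := by
  induction j generalizing c with
  | zero => exact ⟨|c|, abs_nonneg _, fun i x _ => by simp⟩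
  | succ j ih =>
    exact ⟨⟨|c|, abs_nonneg _, fun i x _ => by simp⟩, fun _ _ => 0,
      fun i x _ => by simpa using hasDerivAt_const x c, ih 0⟩

theorem const_mul {j : ℕ} {g : ι → ℝ → ℝ} (c : ℝ) (hg : EulerBounded W j g) :
    EulerBounded W j fun i x => c * g i x := by
  simpa using (const c j).mul hg

/-- Powers of solutions of `x g' = c g (1 - g)` with `0 ≤ g ≤ 1`. -/
theorem logistic_pow {g : ι → ℝ → ℝ} (c : ℝ) (h0 : ∀ i x, 0 < x → 0 ≤ g i x)
    (h1 : ∀ i x, 0 < x → g i x ≤ 1)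
    (hd : ∀ i x, 0 < x → HasDerivAt (g i) (c * (g i x * (1 - g i x)) / x) x) (k j : ℕ) :
    EulerBounded (fun i x => g i x ^ k) j fun i x => g i x ^ k := by
  have hb : ∃ C : ℝ, 0 ≤ C ∧ ∀ i, ∀ x, 0 < x → |g i x| ≤ C * 1 :=
    ⟨1, zero_le_one, fun i x hx => by simpa [abs_of_nonneg (h0 i x hx)] using h1 i x hx⟩
  -- The Euler derivative c g (1 - g) is a polynomial in g, so all iterates are bounded by
  -- constants.
  have hone : EulerBounded (fun (_ : ι) _ => 1) j g := by
    induction j with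
    | zero => exact hb
    | succ j ih =>
      refine ⟨hb, fun i x => c * (g i x * (1 + -1 * g i x)), fun i x hx => ?_, ?_⟩
      · convert! hd i x hx using 2
        ring
      · simpa using (ih.mul ((const 1 j).add (ih.const_mul (-1)))).const_mul c
  have hbk : ∃ C : ℝ, 0 ≤ C ∧ ∀ i, ∀ x, 0 < x → |g i x ^ k| ≤ C * g i x ^ k :=
    ⟨1, zero_le_one, fun i x hx => by rw [abs_of_nonneg (pow_nonneg (h0 i x hx) k), one_mul]⟩
  induction j with
  | zero => exact hbk
  | succ j ih =>
    -- The Euler derivative of g ^ k is g ^ k times k c (1 - g), so the weight g ^ k survives each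
    -- step.
    refine ⟨hbk, fun i x => g i x ^ k * ((k * c) * (1 + -1 * g i x)), fun i x hx => ?_, ?_⟩
    · convert! (hd i x hx).pow k using 1
      rcases k with _ | k
      · simp
      · simp only [Nat.add_sub_cancel]
        field_simp
        ring
    · simpa using (ih hone.of_succ).mul
        (((const 1 j).add (hone.of_succ.const_mul (-1))).const_mul (k * c))

end EulerBounded

/-! ### Mellin transforms and their decay on vertical lines -/

theorem exp_mul_cpow_sub_one (y : ℝ) (s : ℂ) :
    Complex.exp y * Complex.exp y ^ (s - 1) = Complex.exp (s * y) := by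
  rw [Complex.cpow_def_of_ne_zero (Complex.exp_ne_zero _),
    Complex.log_exp (by simp [Real.pi_pos]) (by simpa using Real.pi_nonneg), ← Complex.exp_add]
  ring_nf

/-- The Mellin transform in logarithmic coordinates. -/
theorem mellinConvergent_iff_integrable_exp (f : ℝ → ℂ) (s : ℂ) :
    MellinConvergent f s ↔ Integrable fun y : ℝ => Complex.exp (s * y) * f (Real.exp y) := by
  rw [MellinConvergent, ← Real.range_exp, ← image_univ,
    integrableOn_image_iff_integrableOn_abs_deriv_smul MeasurableSet.univ
      (fun x _ => (Real.hasDerivAt_exp x).hasDerivWithinAt) Real.exp_injective.injOn,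
    integrableOn_univ]
  refine integrable_congr (ae_of_all _ fun y => ?_)
  simp only [abs_of_pos (Real.exp_pos y), smul_eq_mul, Complex.real_smul, Complex.ofReal_exp]
  rw [← mul_assoc, exp_mul_cpow_sub_one]

theorem mellin_eq_integral_exp (f : ℝ → ℂ) (s : ℂ) :
    mellin f s = ∫ y : ℝ, Complex.exp (s * y) * f (Real.exp y) := by
  rw [mellin, ← Real.range_exp, ← image_univ,
    integral_image_eq_integral_abs_deriv_smul MeasurableSet.univ
      (fun x _ => (Real.hasDerivAt_exp x).hasDerivWithinAt) Real.exp_injective.injOn,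
    setIntegral_univ]
  refine integral_congr_ae (ae_of_all _ fun y => ?_)
  simp only [abs_of_pos (Real.exp_pos y), smul_eq_mul, Complex.real_smul, Complex.ofReal_exp]
  rw [← mul_assoc, exp_mul_cpow_sub_one]

/-- The Mellin transform turns the Euler operator `x d/dx` into multiplication by `-s`. -/
theorem mellin_euler {g g' : ℝ → ℝ} {s : ℂ}
    (hd : ∀ x, 0 < x → HasDerivAt g (g' x / x) x)
    (hg : MellinConvergent (fun x => (g x : ℂ)) s)
    (hg' : MellinConvergent (fun x => (g' x : ℂ)) s) :
    mellin (fun x => (g' x : ℂ)) s = -s * mellin (fun x => (g x : ℂ)) s := by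
  have h1 := (mellinConvergent_iff_integrable_exp _ _).1 hg
  have h2 := (mellinConvergent_iff_integrable_exp _ _).1 hg'
  have hder : ∀ y : ℝ, HasDerivAt (fun y : ℝ => Complex.exp (s * y) * (g (Real.exp y) : ℂ))
      (s * (Complex.exp (s * y) * (g (Real.exp y) : ℂ)) +
        Complex.exp (s * y) * (g' (Real.exp y) : ℂ)) y := by
    intro y
    have e1 : HasDerivAt (fun y : ℝ => Complex.exp (s * y)) (Complex.exp (s * y) * (s * 1)) y :=
      ((Complex.ofRealCLM.hasDerivAt (x := y)).const_mul s).cexp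
    have e2 := (((hd _ (Real.exp_pos y)).comp y (Real.hasDerivAt_exp y)).ofReal_comp)
    convert! e1.mul e2 using 1
    have := Real.exp_ne_zero y
    rw [div_mul_cancel₀ _ this]
    simp
    ring
  -- In the variable y = log x this is integration by parts on the whole line; integrability of the
  -- function and its derivative removes the boundary terms.
  have h3 := integral_eq_zero_of_hasDerivAt_of_integrable hder ((h1.const_mul s).add h2) h1
  rw [integral_add (h1.const_mul s) h2, integral_const_mul] at h3
  rw [mellin_eq_integral_exp, mellin_eq_integral_exp]
  linear_combination h3

theorem norm_mellin_le {W : ℝ → ℝ} {g : ℝ → ℝ} {C : ℝ} {s : ℂ}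
    (hW : IntegrableOn (fun x => x ^ (s.re - 1) * W x) (Ioi 0))
    (hg : ∀ x, 0 < x → |g x| ≤ C * W x) :
    ‖mellin (fun x => (g x : ℂ)) s‖ ≤ C * ∫ x in Ioi 0, x ^ (s.re - 1) * W x := by
  rw [mellin, ← integral_const_mul]
  refine norm_integral_le_of_norm_le (hW.const_mul C) ?_
  filter_upwards [ae_restrict_mem measurableSet_Ioi] with x hx
  rw [norm_smul, Complex.norm_cpow_eq_rpow_re_of_pos hx, Complex.norm_real, Real.norm_eq_abs]
  simp only [Complex.sub_re, Complex.one_re]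
  calc _ ≤ x ^ (s.re - 1) * (C * W x) := by
        gcongr
        · exact Real.rpow_nonneg (le_of_lt hx) _
        · exact hg x hx
    _ = _ := by ring

theorem mellinConvergent_of_le {W : ℝ → ℝ} {g : ℝ → ℝ} {C : ℝ} {s : ℂ}
    (hm : AEStronglyMeasurable g (volume.restrict (Ioi 0)))
    (hW : IntegrableOn (fun x => x ^ (s.re - 1) * W x) (Ioi 0))
    (hg : ∀ x, 0 < x → |g x| ≤ C * W x) :
    MellinConvergent (fun x => (g x : ℂ)) s := by
  have hc : ContinuousOn (fun x : ℝ => (x : ℂ) ^ (s - 1)) (Ioi 0) := fun x hx =>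
    (Complex.continuousAt_ofReal_cpow_const x (s - 1) (Or.inr (ne_of_gt hx))).continuousWithinAt
  refine (hW.const_mul C).mono' ((hc.aestronglyMeasurable measurableSet_Ioi).smul
    (Complex.continuous_ofReal.comp_aestronglyMeasurable hm)) ?_
  filter_upwards [ae_restrict_mem measurableSet_Ioi] with x hx
  rw [norm_smul, Complex.norm_cpow_eq_rpow_re_of_pos hx, Complex.norm_real, Real.norm_eq_abs]
  simp only [Complex.sub_re, Complex.one_re]
  calc _ ≤ x ^ (s.re - 1) * (C * W x) := by
        gcongr
        · exact Real.rpow_nonneg (le_of_lt hx) _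
        · exact hg x hx
    _ = _ := by ring

/-- Each Euler derivative contributes one factor -s, so j of them trade the trivial bound on the
transform for decay of order j. The constant depends neither on i nor on s. -/
theorem EulerBounded.norm_mellin_le {ι : Type*} {W : ι → ℝ → ℝ} {j : ℕ} {g : ι → ℝ → ℝ}
    (h : EulerBounded W j g)
    (hm : ∀ i, AEStronglyMeasurable (g i) (volume.restrict (Ioi 0))) :
    ∃ C : ℝ, 0 ≤ C ∧ ∀ i, ∀ s : ℂ, IntegrableOn (fun x => x ^ (s.re - 1) * W i x) (Ioi 0) →
      ‖s‖ ^ j * ‖mellin (fun x => (g i x : ℂ)) s‖ ≤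
        C * ∫ x in Ioi 0, x ^ (s.re - 1) * W i x := by
  induction j generalizing g with
  | zero =>
    obtain ⟨C, hC, hg⟩ := h
    exact ⟨C, hC, fun i s hs => by simpa using FoxHFading.norm_mellin_le hs (hg i)⟩
  | succ j ih =>
    obtain ⟨⟨C₀, hC₀, hg⟩, g', hd, hg'⟩ := h
    have hm' : ∀ i, AEStronglyMeasurable (g' i) (volume.restrict (Ioi 0)) := fun i => by
      -- On (0, ∞) the function g' i is x times the derivative of g i, and `deriv` is always
      -- measurable.
      refine ((measurable_id.mul (measurable_deriv (g i))).aestronglyMeasurable).congr ?_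
      filter_upwards [ae_restrict_mem measurableSet_Ioi] with x hx
      have hx' : x ≠ 0 := ne_of_gt hx
      simp only [Pi.mul_apply, id, (hd i x hx).deriv]
      field_simp
    obtain ⟨C, hC, hb⟩ := ih hg' hm'
    obtain ⟨C₁, hC₁, hg1⟩ := hg'.bound
    refine ⟨C, hC, fun i s hs => ?_⟩
    have e := mellin_euler (hd i) (mellinConvergent_of_le (hm i) hs (hg i))
      (mellinConvergent_of_le (hm' i) hs (hg1 i))
    have := hb i s hs
    rw [e, norm_mul, norm_neg, ← mul_assoc, ← pow_succ] at this
    exact this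

theorem EulerBounded.norm_mellin_le_one_add {ι : Type*} {W : ι → ℝ → ℝ} {g : ι → ℝ → ℝ}
    (h : ∀ j, EulerBounded W j g)
    (hm : ∀ i, AEStronglyMeasurable (g i) (volume.restrict (Ioi 0))) (j : ℕ) :
    ∃ C : ℝ, 0 ≤ C ∧ ∀ i, ∀ s : ℂ, IntegrableOn (fun x => x ^ (s.re - 1) * W i x) (Ioi 0) →
      (1 + |s.im|) ^ j * ‖mellin (fun x => (g i x : ℂ)) s‖ ≤
        C * ∫ x in Ioi 0, x ^ (s.re - 1) * W i x := by
  obtain ⟨C₀, hC₀, h0⟩ := (h 0).norm_mellin_le hm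
  obtain ⟨C₁, hC₁, h1⟩ := (h j).norm_mellin_le hm
  refine ⟨2 ^ j * (C₀ + C₁), by positivity, fun i s hs => ?_⟩
  have e0 := h0 i s hs
  have e1 := h1 i s hs
  rw [pow_zero, one_mul] at e0
  have hle : (1 + |s.im|) ^ j ≤ 2 ^ j * (1 + ‖s‖ ^ j) := by
    have hs' := Complex.abs_im_le_norm s
    have h2 : 1 + |s.im| ≤ 2 * max 1 ‖s‖ := by
      have := le_max_left 1 ‖s‖
      have := le_max_right 1 ‖s‖
      linarith
    calc _ ≤ (2 * max 1 ‖s‖) ^ j := by gcongr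
      _ = 2 ^ j * (max 1 ‖s‖) ^ j := mul_pow _ _ _
      _ ≤ _ := by
        gcongr
        rcases max_choice 1 ‖s‖ with hmx | hmx <;> rw [hmx]
        · rw [one_pow]; linarith [pow_nonneg (norm_nonneg s) j]
        · linarith
  calc _ ≤ 2 ^ j * (1 + ‖s‖ ^ j) * ‖mellin (fun x => (g i x : ℂ)) s‖ := by gcongr
    _ = 2 ^ j * (‖mellin (fun x => (g i x : ℂ)) s‖ +
        ‖s‖ ^ j * ‖mellin (fun x => (g i x : ℂ)) s‖) := by ring
    _ ≤ 2 ^ j * (C₀ * (∫ x in Ioi 0, x ^ (s.re - 1) * W i x) +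
        C₁ * ∫ x in Ioi 0, x ^ (s.re - 1) * W i x) := by gcongr
    _ = _ := by ring

/-! ### The cut-off logarithm -/

/-- `log (1 + x)`, cut off at `0` and at `∞` by rational factors which increase to `1`. -/
noncomputable def cutLog (k : ℕ) (i : ℕ) (x : ℝ) : ℝ :=
  (x / (((i : ℝ) + 1)⁻¹ + x)) ^ k * (1 / (1 + ((i : ℝ) + 1)⁻¹ * x)) ^ k * Real.log (1 + x)

theorem eulerBounded_log (j : ℕ) :
    EulerBounded (fun (_ : ℕ) x => Real.log (1 + x)) j fun _ x => Real.log (1 + x) := by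
  have hlog : ∀ x : ℝ, 0 < x → 0 ≤ Real.log (1 + x) := fun x hx => Real.log_nonneg (by linarith)
  have hb : ∃ C : ℝ, 0 ≤ C ∧ ∀ _ : ℕ, ∀ x : ℝ, 0 < x →
      |Real.log (1 + x)| ≤ C * Real.log (1 + x) :=
    ⟨1, zero_le_one, fun _ x hx => by rw [abs_of_nonneg (hlog x hx), one_mul]⟩
  cases j with
  | zero => exact hb
  | succ j =>
    have hr := EulerBounded.logistic_pow (ι := ℕ) (g := fun _ x => x / (1 + x)) 1
      (fun _ x hx => by positivity)
      (fun _ x hx => by rw [div_le_one (by positivity)]; linarith)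
      (fun _ x hx => by
        have h1 : (1 + x) ≠ 0 := by positivity
        convert! (hasDerivAt_id x).div ((hasDerivAt_id x).const_add 1) h1 using 1
        simp only [id]
        field_simp) 1 j
    refine ⟨hb, fun _ x => x / (1 + x), fun _ x hx => ?_, ?_⟩
    · have h1 : (1 + x) ≠ 0 := by positivity
      convert! ((hasDerivAt_id x).const_add 1).log h1 using 1
      simp only [id]
      field_simp
    -- The bound x/(1+x) ≤ log(1+x) lets the logarithm remain the weight after one Euler derivative;
    -- from there on the logistic case applies.
    · simp only [pow_one] at hr
      refine hr.mono fun _ x hx => ?_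
      have := Real.one_sub_inv_le_log_of_pos (x := 1 + x) (by positivity)
      convert this using 1
      field_simp
      ring

/-- Both rational factors solve the logistic equation, with c = 1 and c = -1, for every value of the
cut-off parameter; hence the constants do not depend on i and the weight is the function itself. -/
theorem eulerBounded_cutLog (k j : ℕ) : EulerBounded (cutLog k) j (cutLog k) := by
  have h1 := EulerBounded.logistic_pow (ι := ℕ)
    (g := fun i x => x / (((i : ℝ) + 1)⁻¹ + x)) 1
    (fun i x hx => by positivity)
    (fun i x hx => by
      have : 0 < ((i : ℝ) + 1)⁻¹ := by positivity
      rw [div_le_one (by positivity)]; linarith)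
    (fun i x hx => by
      have h1 : (((i : ℝ) + 1)⁻¹ + x) ≠ 0 := by positivity
      convert! (hasDerivAt_id x).div ((hasDerivAt_id x).const_add ((i : ℝ) + 1)⁻¹) h1 using 1
      simp only [id]
      have h2 : ((i : ℝ) + 1) ≠ 0 := by positivity
      field_simp) k j
  have h2 := EulerBounded.logistic_pow (ι := ℕ)
    (g := fun i x => 1 / (1 + ((i : ℝ) + 1)⁻¹ * x)) (-1)
    (fun i x hx => by positivity)
    (fun i x hx => by
      have : 0 < ((i : ℝ) + 1)⁻¹ * x := by positivity
      rw [div_le_one (by positivity)]; linarith)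
    (fun i x hx => by
      have h1 : (1 + ((i : ℝ) + 1)⁻¹ * x) ≠ 0 := by positivity
      convert! (hasDerivAt_const x (1 : ℝ)).div
        (((hasDerivAt_id x).const_mul ((i : ℝ) + 1)⁻¹).const_add 1) h1 using 1
      simp only [id]
      have h2 : ((i : ℝ) + 1) ≠ 0 := by positivity
      field_simp
      ring) k j
  exact (h1.mul h2).mul (eulerBounded_log j)

theorem cutLog_nonneg (k i : ℕ) {x : ℝ} (hx : 0 < x) : 0 ≤ cutLog k i x := by
  have := Real.log_nonneg (x := 1 + x) (by linarith)
  unfold cutLog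
  positivity

theorem cutLog_le_log (k i : ℕ) {x : ℝ} (hx : 0 < x) : cutLog k i x ≤ Real.log (1 + x) := by
  have := Real.log_nonneg (x := 1 + x) (by linarith)
  have h1 : 0 < ((i : ℝ) + 1)⁻¹ := by positivity
  have h2 : 0 < ((i : ℝ) + 1)⁻¹ * x := by positivity
  refine mul_le_of_le_one_left this (mul_le_one₀ (pow_le_one₀ (by positivity) ?_) (by positivity)
    (pow_le_one₀ (by positivity) ?_))
  · rw [div_le_one (by positivity)]; linarith
  · rw [div_le_one (by positivity)]; linarith

theorem cutLog_monotone (k : ℕ) {x : ℝ} (hx : 0 < x) : Monotone fun i => cutLog k i x := by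
  intro i j hij
  have hl := Real.log_nonneg (x := 1 + x) (by linarith)
  have : ((j : ℝ) + 1)⁻¹ ≤ ((i : ℝ) + 1)⁻¹ := by gcongr
  change cutLog k i x ≤ cutLog k j x
  unfold cutLog
  gcongr

theorem tendsto_cutLog (k : ℕ) {x : ℝ} (hx : 0 < x) :
    Tendsto (fun i => cutLog k i x) atTop (𝓝 (Real.log (1 + x))) := by
  have h0 : Tendsto (fun i : ℕ => ((i : ℝ) + 1)⁻¹) atTop (𝓝 0) := by
    simpa using tendsto_one_div_add_atTop_nhds_zero_nat (𝕜 := ℝ)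
  have h1 : Tendsto (fun i : ℕ => x / (((i : ℝ) + 1)⁻¹ + x)) atTop (𝓝 1) := by
    have := (tendsto_const_nhds (x := x)).div (h0.add_const x) (by simpa using hx.ne')
    rwa [zero_add, div_self hx.ne'] at this
  have h2 : Tendsto (fun i : ℕ => 1 / (1 + ((i : ℝ) + 1)⁻¹ * x)) atTop (𝓝 1) := by
    have := (tendsto_const_nhds (x := (1 : ℝ))).div ((h0.mul_const x).const_add 1) (by simp)
    simpa [Pi.div_def] using this
  simpa [cutLog] using ((h1.pow k).mul (h2.pow k)).mul_const (Real.log (1 + x))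

theorem continuousOn_log_one_add : ContinuousOn (fun x : ℝ => Real.log (1 + x)) (Ioi 0) := by
  refine ContinuousOn.log (by fun_prop) fun x hx => ?_
  have : (0 : ℝ) < x := hx
  positivity

theorem continuousOn_cutLog (k i : ℕ) : ContinuousOn (cutLog k i) (Ioi 0) := by
  have h1 : 0 < ((i : ℝ) + 1)⁻¹ := by positivity
  refine ContinuousOn.mul (.mul (.pow (.div (by fun_prop) (by fun_prop) fun x hx => ?_) _)
    (.pow (.div (by fun_prop) (by fun_prop) fun x hx => ?_) _)) continuousOn_log_one_add
  all_goals
    have : (0 : ℝ) < x := hx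
    positivity

/-- One of the k + 1 powers of the cut-off is spent on log(1+x) ≤ x; the other k give the decay. -/
theorem isBigO_cutLog_atTop (k i : ℕ) :
    cutLog (k + 1) i =O[atTop] fun x => x ^ (-(k : ℝ)) := by
  refine Asymptotics.IsBigO.of_bound (((i : ℝ) + 1) ^ (k + 1)) ?_
  filter_upwards [eventually_gt_atTop 0] with x hx
  have hl := Real.log_nonneg (x := 1 + x) (by linarith)
  have hl2 : Real.log (1 + x) ≤ x := by
    have := Real.log_le_sub_one_of_pos (x := 1 + x) (by linarith)
    linarith
  have h1 : 0 < ((i : ℝ) + 1)⁻¹ := by positivity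
  rw [Real.norm_of_nonneg (cutLog_nonneg _ i hx), Real.norm_of_nonneg (Real.rpow_nonneg hx.le _),
    Real.rpow_neg hx.le, Real.rpow_natCast]
  calc cutLog (k + 1) i x ≤ 1 ^ (k + 1) * (1 / (((i : ℝ) + 1)⁻¹ * x)) ^ (k + 1) * x := by
        unfold cutLog
        gcongr
        · rw [div_le_one (by positivity)]; linarith
        · linarith
    _ = _ := by
        rw [one_pow, one_mul, div_pow, one_pow, mul_pow, inv_pow, pow_succ x k]
        field_simp

theorem isBigO_cutLog_zero (k i : ℕ) :
    cutLog (k + 1) i =O[𝓝[>] 0] fun x => x ^ (-(-(k : ℝ))) := by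
  refine Asymptotics.IsBigO.of_bound (((i : ℝ) + 1) ^ (k + 1)) ?_
  filter_upwards [Ioo_mem_nhdsGT zero_lt_one] with x hx
  obtain ⟨hx, hx1⟩ := hx
  have hl := Real.log_nonneg (x := 1 + x) (by linarith)
  have hl2 : Real.log (1 + x) ≤ x := by
    have := Real.log_le_sub_one_of_pos (x := 1 + x) (by linarith)
    linarith
  have h1 : 0 < ((i : ℝ) + 1)⁻¹ := by positivity
  have h2 : 0 < ((i : ℝ) + 1)⁻¹ * x := by positivity
  rw [Real.norm_of_nonneg (cutLog_nonneg _ i hx), Real.norm_of_nonneg (Real.rpow_nonneg hx.le _),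
    neg_neg, Real.rpow_natCast]
  calc cutLog (k + 1) i x ≤ (x / ((i : ℝ) + 1)⁻¹) ^ (k + 1) * 1 ^ (k + 1) * 1 := by
        unfold cutLog
        gcongr
        · linarith
        · rw [div_le_one (by positivity)]; linarith
        · linarith
    _ = ((i : ℝ) + 1) ^ (k + 1) * (x ^ k * x) := by
        rw [one_pow, mul_one, mul_one, div_inv_eq_mul, mul_pow, ← pow_succ, mul_comm]
    _ ≤ ((i : ℝ) + 1) ^ (k + 1) * x ^ k := by
        gcongr
        exact mul_le_of_le_one_right (by positivity) hx1.le

theorem isBigO_ofReal {g : ℝ → ℝ} {l : Filter ℝ} {h : ℝ → ℝ} (hg : g =O[l] h) :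
    (fun x => (g x : ℂ)) =O[l] h :=
  (Asymptotics.IsBigO.of_bound 1 (.of_forall fun x => by simp)).trans hg

theorem locallyIntegrableOn_cutLog (k i : ℕ) :
    LocallyIntegrableOn (fun x => (cutLog k i x : ℂ)) (Ioi 0) :=
  (Complex.continuous_ofReal.comp_continuousOn (continuousOn_cutLog k i)).locallyIntegrableOn
    measurableSet_Ioi

theorem mellinConvergent_cutLog {k : ℕ} (i : ℕ) {s : ℂ} (hs : |s.re| < k) :
    MellinConvergent (fun x => (cutLog (k + 1) i x : ℂ)) s :=
  mellinConvergent_of_isBigO_rpow (locallyIntegrableOn_cutLog _ _)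
    (isBigO_ofReal (isBigO_cutLog_atTop k i)) (abs_lt.1 hs).2
    (isBigO_ofReal (isBigO_cutLog_zero k i)) (abs_lt.1 hs).1

theorem differentiableAt_mellin_cutLog {k : ℕ} (i : ℕ) {s : ℂ} (hs : |s.re| < k) :
    DifferentiableAt ℂ (mellin fun x => (cutLog (k + 1) i x : ℂ)) s :=
  mellin_differentiableAt_of_isBigO_rpow (locallyIntegrableOn_cutLog _ _)
    (isBigO_ofReal (isBigO_cutLog_atTop k i)) (abs_lt.1 hs).2
    (isBigO_ofReal (isBigO_cutLog_zero k i)) (abs_lt.1 hs).1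

/-! ### The Mellin transform of log(1+x) -/

theorem mellinConvergent_log {s : ℂ} (h1 : -1 < s.re) (h2 : s.re < 0) :
    MellinConvergent (fun x => (Real.log (1 + x) : ℂ)) s := by
  refine mellinConvergent_of_isBigO_rpow (a := s.re / 2) (b := -1)
    ((Complex.continuous_ofReal.comp_continuousOn continuousOn_log_one_add).locallyIntegrableOn
      measurableSet_Ioi) (isBigO_ofReal ?_) (by linarith) (isBigO_ofReal ?_) h1
  · have hε : 0 < -(s.re / 2) := by linarith
    refine Asymptotics.IsBigO.of_bound (2 ^ (-(s.re / 2)) / (-(s.re / 2))) ?_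
    filter_upwards [eventually_ge_atTop 1] with x hx
    rw [Real.norm_of_nonneg (Real.log_nonneg (by linarith)),
      Real.norm_of_nonneg (Real.rpow_nonneg (by linarith) _)]
    calc _ ≤ (1 + x) ^ (-(s.re / 2)) / (-(s.re / 2)) :=
          Real.log_le_rpow_div (by linarith) hε
      _ ≤ (2 * x) ^ (-(s.re / 2)) / (-(s.re / 2)) := by
          gcongr
          linarith
      _ = _ := by
          rw [Real.mul_rpow (by norm_num) (by linarith)]
          ring
  · refine Asymptotics.IsBigO.of_bound 1 ?_
    filter_upwards [self_mem_nhdsWithin] with x hx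
    have hx' : (0 : ℝ) < x := hx
    rw [Real.norm_of_nonneg (Real.log_nonneg (by linarith)),
      Real.norm_of_nonneg (Real.rpow_nonneg hx'.le _), neg_neg, Real.rpow_one, one_mul]
    have := Real.log_le_sub_one_of_pos (x := 1 + x) (by linarith)
    linarith

theorem integrableOn_rpow_mul_of_mellinConvergent {g : ℝ → ℝ} {s : ℂ}
    (h0 : ∀ x, 0 < x → 0 ≤ g x) (h : MellinConvergent (fun x => (g x : ℂ)) s) :
    IntegrableOn (fun x => x ^ (s.re - 1) * g x) (Ioi 0) := by
  refine h.norm.congr ?_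
  filter_upwards [ae_restrict_mem measurableSet_Ioi] with x hx
  rw [norm_smul, Complex.norm_cpow_eq_rpow_re_of_pos hx, Complex.norm_real,
    Real.norm_of_nonneg (h0 x hx)]
  simp

theorem mellinConvergent_div_one_add {s : ℂ} (h1 : -1 < s.re) (h2 : s.re < 0) :
    MellinConvergent (fun x : ℝ => ((x / (1 + x) : ℝ) : ℂ)) s := by
  refine mellinConvergent_of_le (W := fun x => Real.log (1 + x)) (C := 1) ?_
    (integrableOn_rpow_mul_of_mellinConvergent
      (fun x hx => Real.log_nonneg (by linarith)) (mellinConvergent_log h1 h2)) fun x hx => ?_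
  · exact (by fun_prop : Measurable fun x : ℝ => x / (1 + x)).aestronglyMeasurable
  · rw [abs_of_nonneg (by positivity), one_mul]
    have := Real.one_sub_inv_le_log_of_pos (x := 1 + x) (by positivity)
    convert this using 1
    field_simp
    ring

theorem ofReal_cpow_mul_ofReal {x : ℝ} (hx : 0 < x) (s : ℂ) : (x : ℂ) ^ (s - 1) * x = (x : ℂ) ^ s := by
  have hx' : (x : ℂ) ≠ 0 := by exact_mod_cast hx.ne'
  rw [Complex.cpow_sub _ _ hx', Complex.cpow_one, div_mul_cancel₀ _ hx']

/-- Euler's integral for `Γ(v) Γ(1 - v)`. -/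
theorem mellin_div_one_add {v : ℂ} (h1 : 0 < v.re) (h2 : v.re < 1) :
    mellin (fun x : ℝ => ((x / (1 + x) : ℝ) : ℂ)) (-v) =
      Complex.Gamma v * Complex.Gamma (1 - v) := by
  have hconv := mellinConvergent_div_one_add (s := -v) (by simpa using h2) (by simpa using h1)
  -- Writing 1/(1+x) as an integral of exp(-(1+x)t) and exchanging integrals, the x-integral gives
  -- Γ(1-v) t^(v-1) and the t-integral then gives Γ(v).
  have hinner : ∀ x : ℝ, 0 < x → ∫ t in Ioi (0 : ℝ), Real.exp (-(1 + x) * t) = 1 / (1 + x) := by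
    intro x hx
    rw [integral_exp_mul_Ioi (by linarith)]
    rw [mul_zero, Real.exp_zero, neg_div_neg_eq]
  have hnorm : ∀ x : ℝ, 0 < x → ∀ t : ℝ,
      ‖(x : ℂ) ^ (-v) * (Real.exp (-(1 + x) * t) : ℂ)‖ =
        ‖(x : ℂ) ^ (-v)‖ * Real.exp (-(1 + x) * t) := by
    intro x hx t
    rw [norm_mul, Complex.norm_real, Real.norm_of_nonneg (Real.exp_nonneg _)]
  have hsmul : ∀ x : ℝ, 0 < x → (x : ℂ) ^ (-v - 1) • ((x / (1 + x) : ℝ) : ℂ) =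
      (x : ℂ) ^ (-v) * ((1 / (1 + x) : ℝ) : ℂ) := by
    intro x hx
    rw [← ofReal_cpow_mul_ofReal hx (-v), smul_eq_mul, mul_assoc, ← Complex.ofReal_mul, mul_one_div]
  have hint : Integrable (Function.uncurry fun x t : ℝ =>
      (x : ℂ) ^ (-v) * (Real.exp (-(1 + x) * t) : ℂ))
      ((volume.restrict (Ioi 0)).prod (volume.restrict (Ioi 0))) := by
    rw [integrable_prod_iff]
    · constructor
      · filter_upwards [ae_restrict_mem measurableSet_Ioi] with x hx
        have hx' : (0 : ℝ) < x := hx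
        exact Integrable.const_mul (c := (x : ℂ) ^ (-v))
          (integrableOn_exp_mul_Ioi (a := -(1 + x)) (by linarith) 0).ofReal
      · refine hconv.norm.congr ?_
        filter_upwards [ae_restrict_mem measurableSet_Ioi] with x hx
        have hx' : (0 : ℝ) < x := hx
        simp only [Function.uncurry, hnorm x hx]
        rw [integral_const_mul, hinner x hx, hsmul x hx, norm_mul, Complex.norm_real,
          Real.norm_of_nonneg (by positivity)]
    · refine Measurable.aestronglyMeasurable ?_
      unfold Function.uncurry
      fun_prop
  calc mellin (fun x : ℝ => ((x / (1 + x) : ℝ) : ℂ)) (-v)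
      = ∫ x in Ioi (0 : ℝ), ∫ t in Ioi (0 : ℝ),
          (x : ℂ) ^ (-v) * (Real.exp (-(1 + x) * t) : ℂ) := by
        refine setIntegral_congr_fun measurableSet_Ioi fun x hx => ?_
        rw [hsmul x hx, integral_const_mul, integral_complex_ofReal, hinner x hx]
    _ = ∫ t in Ioi (0 : ℝ), ∫ x in Ioi (0 : ℝ),
          (x : ℂ) ^ (-v) * (Real.exp (-(1 + x) * t) : ℂ) := integral_integral_swap hint
    _ = ∫ t in Ioi (0 : ℝ), Complex.Gamma (1 - v) * ((Real.exp (-t) : ℂ) * (t : ℂ) ^ (v - 1)) := by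
        refine setIntegral_congr_fun measurableSet_Ioi fun t ht => ?_
        have ht' : (0 : ℝ) < t := ht
        have e := Complex.integral_cpow_mul_exp_neg_mul_Ioi (a := 1 - v) (r := t)
          (by simpa using h2) (by simpa using ht')
        have e2 : ∀ x : ℝ, (x : ℂ) ^ (-v) * (Real.exp (-(1 + x) * t) : ℂ) =
            (Real.exp (-t) : ℂ) * ((x : ℂ) ^ (1 - v - 1) * Complex.exp (-t * x)) := by
          intro x
          have : (1 - v - 1) = -v := by ring
          rw [this, show -(1 + x) * t = -t + -t * x by ring, Real.exp_add]
          push_cast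
          ring
        simp only [e2]
        rw [integral_const_mul]
        simp only [neg_mul]
        rw [e, one_div, Complex.inv_cpow _ _ (by
          rw [Complex.arg_ofReal_of_nonneg ht'.le]; exact Real.pi_pos.ne), ← Complex.cpow_neg,
          neg_sub]
        ring
    _ = _ := by
        rw [integral_const_mul, Complex.Gamma_eq_integral h1, Complex.GammaIntegral, mul_comm]

/-- The Euler derivative of log(1+x) is x/(1+x), so Euler's integral is v times the required
transform. -/
theorem mellin_log_one_add {v : ℂ} (h1 : 0 < v.re) (h2 : v.re < 1) :
    mellin (fun x : ℝ => (Real.log (1 + x) : ℂ)) (-v) =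
      Complex.Gamma v * Complex.Gamma (1 - v) / v := by
  have e := mellin_euler (g := fun x => Real.log (1 + x)) (g' := fun x => x / (1 + x)) (s := -v)
    (fun x hx => by
      have h1 : (1 + x) ≠ 0 := by positivity
      convert! ((hasDerivAt_id x).const_add 1).log h1 using 1
      simp only [id]
      field_simp)
    (mellinConvergent_log (by simpa using h2) (by simpa using h1))
    (mellinConvergent_div_one_add (by simpa using h2) (by simpa using h1))
  have hv : v ≠ 0 := by rintro rfl; simp at h1
  rw [mellin_div_one_add h1 h2, neg_neg] at e
  rw [e]
  field_simp

/-! ### Parseval's formula and continuity of inverse Mellin transforms -/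

theorem ofReal_mul_cpow {a x : ℝ} (ha : 0 < a) (hx : 0 < x) (s : ℂ) :
    ((a * x : ℝ) : ℂ) ^ s = (a : ℂ) ^ s * (x : ℂ) ^ s := by
  rw [Complex.ofReal_mul, Complex.mul_cpow_ofReal_nonneg ha.le hx.le]

/-- Parseval's formula: integration of an inverse Mellin transform against a function whose Mellin
transform converges on the reflected line. -/
theorem integral_mellinInv_mul {K : ℂ → ℂ} {c a : ℝ} (ha : 0 < a)
    (hK : Complex.VerticalIntegrable K c) {G : ℝ → ℂ} (hG : MellinConvergent G (1 - c)) :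
    IntegrableOn (fun x => mellinInv c K (a * x) * G x) (Ioi 0) ∧
    ∫ x in Ioi 0, mellinInv c K (a * x) * G x = (1 / (2 * Real.pi) : ℝ) *
      ∫ t : ℝ, (a : ℂ) ^ (-(c + t * Complex.I)) * K (c + t * Complex.I) *
        mellin G (1 - (c + t * Complex.I)) := by
  have hK' : Integrable fun t : ℝ => (a : ℂ) ^ (-(c + t * Complex.I)) * K (c + t * Complex.I) := by
    refine hK.bdd_mul (c := a ^ (-c)) (Measurable.aestronglyMeasurable (by fun_prop))
      (ae_of_all _ fun t => ?_)
    rw [Complex.norm_cpow_eq_rpow_re_of_pos ha]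
    simp
  -- After splitting off the unimodular factor x^(-it), the integrand is a product of an integrable
  -- function of x and one of t.
  have hint : Integrable (Function.uncurry fun x t : ℝ =>
      (x : ℂ) ^ (-(t * Complex.I)) * (((x : ℂ) ^ (1 - (c : ℂ) - 1) • G x) *
        ((a : ℂ) ^ (-(c + t * Complex.I)) * K (c + t * Complex.I))))
      ((volume.restrict (Ioi 0)).prod volume) := by
    refine (hG.mul_prod hK').bdd_mul (c := 1) (f := fun z : ℝ × ℝ => (z.1 : ℂ) ^ (-(z.2 * Complex.I)))
      (Measurable.aestronglyMeasurable (by fun_prop)) ?_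
    have hprod : ∀ᵐ z : ℝ × ℝ ∂((volume.restrict (Ioi (0 : ℝ))).prod volume), 0 < z.1 :=
      Measure.quasiMeasurePreserving_fst.ae (ae_restrict_mem measurableSet_Ioi)
    filter_upwards [hprod] with z hz
    rw [Complex.norm_cpow_eq_rpow_re_of_pos hz]
    simp
  have e1 : ∀ x : ℝ, 0 < x → mellinInv c K (a * x) * G x = (1 / (2 * Real.pi) : ℝ) *
      ∫ t : ℝ, (x : ℂ) ^ (-(t * Complex.I)) * (((x : ℂ) ^ (1 - (c : ℂ) - 1) • G x) *
        ((a : ℂ) ^ (-(c + t * Complex.I)) * K (c + t * Complex.I))) := by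
    intro x hx
    rw [mellinInv, Complex.real_smul, mul_assoc, ← integral_mul_const]
    congr 2
    funext t
    have hx' : (x : ℂ) ≠ 0 := by exact_mod_cast hx.ne'
    rw [ofReal_mul_cpow ha hx, show (-(c + t * Complex.I) : ℂ) =
      -(t * Complex.I) + (1 - (c : ℂ) - 1) by ring, Complex.cpow_add (x := (x : ℂ)) _ _ hx']
    simp only [smul_eq_mul]
    ring
  have e2 : ∀ t : ℝ, ∫ x in Ioi (0 : ℝ), (x : ℂ) ^ (-(t * Complex.I)) *
      (((x : ℂ) ^ (1 - (c : ℂ) - 1) • G x) *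
        ((a : ℂ) ^ (-(c + t * Complex.I)) * K (c + t * Complex.I))) =
      (a : ℂ) ^ (-(c + t * Complex.I)) * K (c + t * Complex.I) *
        mellin G (1 - (c + t * Complex.I)) := by
    intro t
    rw [mellin, ← integral_const_mul]
    refine setIntegral_congr_fun measurableSet_Ioi fun x hx => ?_
    have hx' : (x : ℂ) ≠ 0 := by exact_mod_cast (ne_of_gt hx)
    simp only [smul_eq_mul]
    rw [show (1 - (c + t * Complex.I) - 1 : ℂ) = -(t * Complex.I) + (1 - (c : ℂ) - 1) by ring,
      Complex.cpow_add _ _ hx']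
    ring
  constructor
  · refine (hint.integral_prod_left.const_mul ((1 / (2 * Real.pi) : ℝ) : ℂ)).congr ?_
    filter_upwards [ae_restrict_mem measurableSet_Ioi] with x hx
    exact (e1 x hx).symm
  · rw [setIntegral_congr_fun measurableSet_Ioi e1, integral_const_mul, integral_integral_swap hint]
    simp only [e2]

theorem continuousOn_mellinInv {K : ℂ → ℂ} {c : ℝ} (hK : Complex.VerticalIntegrable K c) :
    ContinuousOn (mellinInv c K) (Ioi 0) := by
  intro x hx
  have hx0 : (0 : ℝ) < x := hx
  refine ContinuousAt.continuousWithinAt ?_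
  unfold mellinInv
  refine ContinuousAt.const_smul ?_ _
  have hcr : ContinuousAt (fun y : ℝ => y ^ (-c)) x := Real.continuousAt_rpow_const _ _ (Or.inl hx0.ne')
  refine continuousAt_of_dominated (bound := fun t => (x ^ (-c) + 1) * ‖K (c + t * Complex.I)‖)
    ?_ ?_ (hK.norm.const_mul _) ?_
  · refine Eventually.of_forall fun y => ?_
    have : Measurable fun t : ℝ => (y : ℂ) ^ (-(c + t * Complex.I)) := by fun_prop
    exact this.aestronglyMeasurable.smul hK.aestronglyMeasurable
  · filter_upwards [hcr.eventually (gt_mem_nhds (lt_add_one _)), lt_mem_nhds hx0] with y hy hy0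
    refine ae_of_all _ fun t => ?_
    rw [norm_smul, Complex.norm_cpow_eq_rpow_re_of_pos hy0]
    gcongr
    simpa using hy.le
  · refine ae_of_all _ fun t => ?_
    exact (Complex.continuousAt_ofReal_cpow_const x _ (Or.inr hx0.ne')).smul continuousAt_const

/-! ### The kernel of the capacity formula and its contours -/

theorem capacityUpper_snd_pos {p : ℕ} {up : Fin p → ℝ × ℝ} (hA : ∀ i, 0 < (up i).2)
    (i : Fin (p + 2)) : 0 < (capacityUpper up i).2 := by
  unfold capacityUpper
  refine Fin.cases ?_ (fun i => ?_) i
  · simp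
  · refine Fin.lastCases ?_ (fun i => ?_) i
    · simp
    · simpa [shiftParams] using hA i

theorem capacityLower_snd_pos {q : ℕ} {lo : Fin q → ℝ × ℝ} (hB : ∀ i, 0 < (lo i).2)
    (i : Fin (q + 2)) : 0 < (capacityLower lo i).2 := by
  unfold capacityLower
  refine Fin.cases ?_ (fun i => ?_) i
  · simp
  · refine Fin.cases ?_ (fun i => ?_) i
    · simp
    · simpa [shiftParams] using hB i

/-- The kernel of the capacity formula in terms of the kernel of the density. -/
theorem foxKernel_capacity {m n p q : ℕ} (hnp : n ≤ p) (up : Fin p → ℝ × ℝ)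
    (lo : Fin q → ℝ × ℝ) (v : ℂ) :
    foxKernel (m + 2) (n + 1) (capacityUpper up) (capacityLower lo) v =
      Complex.Gamma v * Complex.Gamma v * Complex.Gamma (1 - v) / Complex.Gamma (1 + v) *
        foxKernel m n up lo (v + 1) := by
  have e1 : ∀ b B : ℝ, ((b + B : ℝ) : ℂ) + B * v = b + B * (v + 1) := by
    intro b B; push_cast; ring
  have e2 : ∀ b B : ℝ, 1 - ((b + B : ℝ) : ℂ) - B * v = 1 - b - B * (v + 1) := by
    intro b B; push_cast; ring
  -- Since n ≤ p, the last upper pair (1,1) belongs to the denominator, where it gives Γ(1+v).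
  have h3 : ¬ p < n := by omega
  have h4 : n ≤ p := hnp
  simp only [foxKernel, Finset.prod_filter]
  rw [Fin.prod_univ_succ, Fin.prod_univ_succ, Fin.prod_univ_succ, Fin.prod_univ_castSucc,
    Fin.prod_univ_succ (n := p + 1), Fin.prod_univ_castSucc, Fin.prod_univ_succ (n := q + 1),
    Fin.prod_univ_succ (n := q)]
  simp only [capacityUpper, capacityLower, shiftParams, Fin.cons_zero, Fin.cons_succ,
    Fin.snoc_last, Fin.snoc_castSucc, Fin.val_zero, Fin.val_succ, Fin.val_castSucc, Fin.val_last,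
    e1, e2, add_lt_add_iff_right, add_le_add_iff_right, h3, h4]
  simp
  rw [div_mul_div_comm]
  congr 1 <;> ring

/-- The adjoined pairs (0,1) confine d to (0, 1), by their poles at 0 and 1; the shifted pairs give
the original conditions at d + 1. -/
theorem SeparatesPoles.of_capacity {m n p q : ℕ} {up : Fin p → ℝ × ℝ} {lo : Fin q → ℝ × ℝ}
    (hA : ∀ i, 0 < (up i).2) (hB : ∀ i, 0 < (lo i).2) {d : ℝ}
    (h : SeparatesPoles (m + 2) (n + 1) (capacityUpper up) (capacityLower lo) d) :
    0 < d ∧ d < 1 ∧ SeparatesPoles m n up lo (d + 1) := by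
  refine ⟨?_, ?_, ⟨fun i hi k => ?_, fun i hi k => ?_⟩⟩
  · simpa [capacityLower] using h.left 0 (by simp) 0
  · simpa [capacityUpper] using h.right 0 (by simp) 0
  · have := h.left i.succ.succ (by simpa using hi) k
    simp only [capacityLower, Fin.cons_succ, shiftParams] at this
    rw [div_lt_iff₀ (hB i)] at this ⊢
    linarith
  · have := h.right i.castSucc.succ (by simpa using hi) k
    simp only [capacityUpper, Fin.cons_succ, Fin.snoc_castSucc, shiftParams] at this
    rw [lt_div_iff₀ (hA i)] at this ⊢
    linarith

/-- Any sufficiently small d > 0 works: the left poles are at most 0, and the finitely many first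
right poles are positive. -/
theorem exists_separatesPoles_capacity {m n p q : ℕ} (hnp : n ≤ p) {up : Fin p → ℝ × ℝ}
    {lo : Fin q → ℝ × ℝ} (hA : ∀ i, 0 < (up i).2) (hB : ∀ i, 0 < (lo i).2)
    (hlo : ∀ i : Fin q, i.val < m → 0 < (lo i).1 + (lo i).2)
    (hup : ∀ i : Fin p, i.val < n → (up i).1 + (up i).2 < 1) :
    ∃ d, SeparatesPoles (m + 2) (n + 1) (capacityUpper up) (capacityLower lo) d := by
  have hev : ∀ᶠ d : ℝ in 𝓝[>] 0, 0 < d ∧ d < 1 ∧ ∀ i : Fin p, i.val < n →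
      d * (up i).2 < 1 - ((up i).1 + (up i).2) := by
    refine (eventually_mem_nhdsWithin (a := (0 : ℝ)) (s := Ioi 0)).and
      ((eventually_nhdsWithin_of_eventually_nhds (gt_mem_nhds one_pos)).and
      (eventually_all.2 fun i => ?_))
    by_cases hi : i.val < n
    · have hc : ContinuousAt (fun d : ℝ => d * (up i).2) 0 := by fun_prop
      have := hc.eventually_lt continuousAt_const
        (show 0 * (up i).2 < 1 - ((up i).1 + (up i).2) by linarith [hup i hi])
      exact eventually_nhdsWithin_of_eventually_nhds (this.mono fun d hd _ => hd)
    · exact Eventually.of_forall fun d h => absurd h hi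
  obtain ⟨d, hd0, hd1, hd⟩ := hev.exists
  refine ⟨d, fun i hi k => ?_, fun i hi k => ?_⟩
  · rw [div_lt_iff₀ (capacityLower_snd_pos hB i)]
    have hk : (0 : ℝ) ≤ k := Nat.cast_nonneg k
    have hpos := mul_pos hd0 (capacityLower_snd_pos hB i)
    suffices 0 ≤ (capacityLower lo i).1 by linarith
    revert hi
    refine Fin.cases ?_ (fun i => Fin.cases ?_ (fun i => ?_) i) i
    · simp [capacityLower]
    · simp [capacityLower]
    · intro hi
      simpa [capacityLower, shiftParams] using (hlo i (by simpa using hi)).le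
  · rw [lt_div_iff₀ (capacityUpper_snd_pos hA i)]
    have hk : (0 : ℝ) ≤ k := Nat.cast_nonneg k
    suffices d * (capacityUpper up i).2 < 1 - (capacityUpper up i).1 by linarith
    revert hi
    refine Fin.cases ?_ (fun i => Fin.lastCases ?_ (fun i => ?_) i) i
    · simpa [capacityUpper] using hd1
    · intro hi
      simp at hi
      omega
    · intro hi
      simpa [capacityUpper, shiftParams] using hd i (by simpa using hi)

theorem foxKernel_capacity_eq_mellin_mul {m n p q : ℕ} (hnp : n ≤ p) (up : Fin p → ℝ × ℝ)
    (lo : Fin q → ℝ × ℝ) {v : ℂ} (h0 : 0 < v.re) (h1 : v.re < 1) :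
    foxKernel (m + 2) (n + 1) (capacityUpper up) (capacityLower lo) v =
      mellin (fun x : ℝ => (Real.log (1 + x) : ℂ)) (-v) * foxKernel m n up lo (v + 1) := by
  have hv : v ≠ 0 := by rintro rfl; simp at h0
  have hΓ := Complex.Gamma_ne_zero_of_re_pos h0
  rw [foxKernel_capacity hnp, mellin_log_one_add h0 h1, add_comm 1 v, Complex.Gamma_add_one v hv]
  congr 1
  field_simp

/-! ### Uniform estimates and limits for the transforms of the cut-offs -/

theorem setIntegral_rpow_mul_cutLog_nonneg (k i : ℕ) (σ : ℝ) :
    0 ≤ ∫ x in Ioi 0, x ^ (σ - 1) * cutLog k i x :=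
  setIntegral_nonneg measurableSet_Ioi fun _ hx =>
    mul_nonneg (Real.rpow_nonneg (le_of_lt hx) _) (cutLog_nonneg k i hx)

theorem integrableOn_rpow_mul_cutLog {k : ℕ} (i : ℕ) {σ : ℝ} (hσ : |σ| < k) :
    IntegrableOn (fun x => x ^ (σ - 1) * cutLog (k + 1) i x) (Ioi 0) := by
  simpa using integrableOn_rpow_mul_of_mellinConvergent (s := (σ : ℂ))
    (fun x hx => cutLog_nonneg (k + 1) i hx) (mellinConvergent_cutLog i (by simpa using hσ))

theorem exists_norm_mellin_cutLog_le (k N : ℕ) : ∃ C : ℝ, 0 ≤ C ∧ ∀ (i : ℕ) (s : ℂ),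
    |s.re| < k → ‖mellin (fun x => (cutLog (k + 1) i x : ℂ)) s‖ ≤
      ((1 + |s.im|) ^ N)⁻¹ * (C * ∫ x in Ioi 0, x ^ (s.re - 1) * cutLog (k + 1) i x) := by
  obtain ⟨C, hC, h⟩ := EulerBounded.norm_mellin_le_one_add (eulerBounded_cutLog (k + 1))
    (fun i => (continuousOn_cutLog (k + 1) i).aestronglyMeasurable measurableSet_Ioi) N
  refine ⟨C, hC, fun i s hs => ?_⟩
  have h0 : 0 < (1 + |s.im|) ^ N := by positivity
  rw [← div_eq_inv_mul, le_div_iff₀' h0]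
  exact h i s (integrableOn_rpow_mul_cutLog i hs)

theorem rpow_le_add_rpow_of_mem_uIcc {x a b c : ℝ} (hx : 0 < x) (hc : c ∈ uIcc a b) :
    x ^ c ≤ x ^ a + x ^ b := by
  have ha := Real.rpow_nonneg hx.le a
  have hb := Real.rpow_nonneg hx.le b
  have key : ∀ a b : ℝ, a ≤ c → c ≤ b → x ^ c ≤ x ^ a ∨ x ^ c ≤ x ^ b := by
    intro a b h1 h2
    rcases le_total 1 x with h | h
    · exact Or.inr (Real.rpow_le_rpow_of_exponent_le h h2)
    · exact Or.inl (Real.rpow_le_rpow_of_exponent_ge hx h h1)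
  rcases mem_uIcc.1 hc with ⟨h1, h2⟩ | ⟨h1, h2⟩ <;> rcases key _ _ h1 h2 with h | h <;> linarith

theorem tendsto_mellin_cutLog (k : ℕ) {v : ℂ} (h0 : 0 < v.re) (h1 : v.re < 1) :
    Tendsto (fun i => mellin (fun x => (cutLog k i x : ℂ)) (-v)) atTop
      (𝓝 (mellin (fun x : ℝ => (Real.log (1 + x) : ℂ)) (-v))) := by
  have hconv := mellinConvergent_log (s := -v) (by simpa using h1) (by simpa using h0)
  have hc : ContinuousOn (fun x : ℝ => (x : ℂ) ^ (-v - 1)) (Ioi 0) := fun x hx =>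
    (Complex.continuousAt_ofReal_cpow_const x _ (Or.inr (ne_of_gt hx))).continuousWithinAt
  refine tendsto_integral_of_dominated_convergence _ (fun i => ?_) hconv.norm (fun i => ?_) ?_
  · exact (hc.smul (Complex.continuous_ofReal.comp_continuousOn
      (continuousOn_cutLog k i))).aestronglyMeasurable measurableSet_Ioi
  · filter_upwards [ae_restrict_mem measurableSet_Ioi] with x hx
    rw [norm_smul, norm_smul, Complex.norm_real, Complex.norm_real,
      Real.norm_of_nonneg (cutLog_nonneg k i hx),
      Real.norm_of_nonneg ((cutLog_nonneg k i hx).trans (cutLog_le_log k i hx))]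
    exact mul_le_mul_of_nonneg_left (cutLog_le_log k i hx) (norm_nonneg _)
  · filter_upwards [ae_restrict_mem measurableSet_Ioi] with x hx
    exact ((Complex.continuous_ofReal.tendsto _).comp (tendsto_cutLog k hx)).const_smul _

theorem continuous_vertical {F : ℂ → ℂ} {c : ℝ}
    (hF : ∀ v : ℂ, v.re = c → ContinuousAt F v) : Continuous fun t : ℝ => F (c + t * Complex.I) := by
  rw [continuous_iff_continuousAt]
  intro t
  exact ContinuousAt.comp (f := fun t : ℝ => (c : ℂ) + t * Complex.I) (hF _ (by simp))
    (by fun_prop)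

/-! ### Contour shift and removal of the cut-off -/

section Capacity

variable {m n p q : ℕ} {up : Fin p → ℝ × ℝ} {lo : Fin q → ℝ × ℝ}

/-- Integration of a Fox function against the cut-off logarithm, with the line of integration
shifted to any other line separating the poles. -/
theorem IsFoxContour.integral_foxH_mul_cutLog (hA : ∀ i, 0 < (up i).2) (hB : ∀ i, 0 < (lo i).2)
    {c b φ : ℝ} (hφ : 0 < φ) (hc : IsFoxContour m n up lo c) (hb : SeparatesPoles m n up lo b)
    {k : ℕ} (hk : |1 - c| < k) (hk' : |1 - b| < k) (i : ℕ) :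
    IntegrableOn (fun x => foxH m n up lo c (φ * x) * (cutLog (k + 1) i x : ℂ)) (Ioi 0) ∧
    ∫ x in Ioi 0, foxH m n up lo c (φ * x) * (cutLog (k + 1) i x : ℂ) = (1 / (2 * Real.pi) : ℝ) *
      ∫ t : ℝ, (φ : ℂ) ^ (-(b + t * Complex.I)) * foxKernel m n up lo (b + t * Complex.I) *
        mellin (fun x => (cutLog (k + 1) i x : ℂ)) (1 - (b + t * Complex.I)) := by
  have hP := integral_mellinInv_mul hφ hc.converges
    (mellinConvergent_cutLog i (s := 1 - (c : ℂ)) (by simpa using hk))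
  refine ⟨hP.1, hP.2.trans ?_⟩
  obtain ⟨E, N, hE, hE0, hEb⟩ := hc.exists_norm_le hA hB hb
  -- N powers absorb the growth of the kernel; one more supplies the factor (1+|t|)⁻¹ required by
  -- the contour shift.
  obtain ⟨C, hC, hCb⟩ := exists_norm_mellin_cutLog_le k (N + 1)
  set J : ℝ → ℝ := fun σ => ∫ x in Ioi 0, x ^ (σ - 1) * cutLog (k + 1) i x with hJ
  have hJ0 : ∀ σ, 0 ≤ J σ := fun σ => setIntegral_rpow_mul_cutLog_nonneg _ _ _
  have hstrip : ∀ σ ∈ uIcc c b, |1 - σ| < k := by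
    intro σ hσ
    rw [abs_lt] at hk hk' ⊢
    have h1 := hσ.1
    have h2 := hσ.2
    constructor
    · rcases le_sup_iff.1 h2 with h | h <;> linarith
    · rcases inf_le_iff.1 h1 with h | h <;> linarith
  have hJb : ∀ σ ∈ uIcc c b, J (1 - σ) ≤ J (1 - c) + J (1 - b) := by
    intro σ hσ
    rw [hJ]
    simp only []
    rw [← integral_add (integrableOn_rpow_mul_cutLog i hk) (integrableOn_rpow_mul_cutLog i hk')]
    refine setIntegral_mono_on (integrableOn_rpow_mul_cutLog i (hstrip σ hσ))
      ((integrableOn_rpow_mul_cutLog i hk).add (integrableOn_rpow_mul_cutLog i hk'))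
      measurableSet_Ioi fun x hx => ?_
    rw [← add_mul]
    refine mul_le_mul_of_nonneg_right (rpow_le_add_rpow_of_mem_uIcc hx ?_)
      (cutLog_nonneg _ _ hx)
    rw [mem_uIcc] at hσ ⊢
    rcases hσ with ⟨h1, h2⟩ | ⟨h1, h2⟩
    · right; constructor <;> linarith
    · left; constructor <;> linarith
  congr 1
  refine (integral_vertical_eq (F := fun s => (φ : ℂ) ^ (-s) * foxKernel m n up lo s *
    mellin (fun x => (cutLog (k + 1) i x : ℂ)) (1 - s))
    (E := fun t => (φ ^ (-c) + φ ^ (-b)) * C * (J (1 - c) + J (1 - b)) * E t)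
    (hE.const_mul _) (fun t => ?_) (fun v hv => ?_) (fun σ hσ t => ?_)).2
  · have := hJ0 (1 - c)
    have := hJ0 (1 - b)
    have := hE0 t
    positivity
  · refine ((DifferentiableAt.const_cpow (by fun_prop) (Or.inl ?_)).mul
      ((hc.separates.of_mem_uIcc hb hv).differentiableAt hA hB)).mul ?_
    · exact_mod_cast hφ.ne'
    · exact (differentiableAt_mellin_cutLog i (s := 1 - v) (by simpa using hstrip _ hv)).fun_comp' v
        (by fun_prop)
  · have h1 := hEb σ hσ t
    have h2 := hCb i (1 - (σ + t * Complex.I)) (by simpa using hstrip σ hσ)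
    simp only [Complex.sub_re, Complex.one_re, Complex.add_re, Complex.ofReal_re, Complex.mul_re,
      Complex.I_re, mul_zero, Complex.ofReal_im, Complex.I_im, mul_one, sub_self, add_zero,
      Complex.sub_im, Complex.one_im, Complex.add_im, Complex.mul_im, zero_add, zero_sub,
      abs_neg] at h2
    have h3 : ‖(φ : ℂ) ^ (-(σ + t * Complex.I))‖ ≤ φ ^ (-c) + φ ^ (-b) := by
      rw [Complex.norm_cpow_eq_rpow_re_of_pos hφ]
      refine rpow_le_add_rpow_of_mem_uIcc hφ ?_
      rw [mem_uIcc] at hσ ⊢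
      simp
      tauto
    have h0 := hE0 t
    have h5 : (0 : ℝ) < 1 + |t| := by positivity
    rw [norm_mul, norm_mul]
    calc _ ≤ (φ ^ (-c) + φ ^ (-b)) * ((1 + |t|) ^ N * E t) *
          (((1 + |t|) ^ (N + 1))⁻¹ * (C * (J (1 - c) + J (1 - b)))) := by
          refine mul_le_mul (mul_le_mul h3 h1 (norm_nonneg _) (by positivity)) (h2.trans ?_)
            (norm_nonneg _) (by positivity)
          gcongr
          exact hJb σ hσ
      _ = _ := by
          rw [pow_succ]
          field_simp

/-- The growth of the kernel of the capacity formula in terms of the cut-off approximations. -/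
theorem IsFoxContour.exists_bound_cutLog (hA : ∀ i, 0 < (up i).2) (hB : ∀ i, 0 < (lo i).2)
    {c d : ℝ} (hc : IsFoxContour m n up lo c) (hd : SeparatesPoles m n up lo (d + 1))
    (h0 : 0 < d) (h1 : d < 1) (k : ℕ) (hk : |d| < k) :
    ∃ E : ℝ → ℝ, Integrable E ∧ ∀ (i : ℕ) (t : ℝ),
      ‖mellin (fun x => (cutLog (k + 1) i x : ℂ)) (-(d + t * Complex.I)) *
        foxKernel m n up lo (d + t * Complex.I + 1)‖ ≤ E t := by
  obtain ⟨E, N, hE, hE0, hEb⟩ := hc.exists_norm_le hA hB hd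
  obtain ⟨C, hC, hCb⟩ := exists_norm_mellin_cutLog_le k N
  -- The weight integral is bounded by that of log(1+x), finite because 0 < d < 1, which removes the
  -- dependence on i. With no contour shift here, N powers of decay suffice.
  refine ⟨fun t => C * (∫ x in Ioi 0, x ^ (-d - 1) * Real.log (1 + x)) * E t, hE.const_mul _,
    fun i t => ?_⟩
  have e1 := hEb (d + 1) right_mem_uIcc t
  have e2 := hCb i (-(d + t * Complex.I)) (by simpa using hk)
  have e3 : ((d + 1 : ℝ) : ℂ) + t * Complex.I = d + t * Complex.I + 1 := by push_cast; ring
  rw [e3] at e1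
  have e4 : ∫ x in Ioi 0, x ^ (-d - 1) * cutLog (k + 1) i x ≤
      ∫ x in Ioi 0, x ^ (-d - 1) * Real.log (1 + x) := by
    refine setIntegral_mono_on (integrableOn_rpow_mul_cutLog i (by rwa [abs_neg])) ?_
      measurableSet_Ioi fun x hx => mul_le_mul_of_nonneg_left (cutLog_le_log _ _ hx)
        (Real.rpow_nonneg (le_of_lt hx) _)
    simpa using integrableOn_rpow_mul_of_mellinConvergent (s := (-d : ℂ))
      (fun x hx => Real.log_nonneg (by linarith))
      (mellinConvergent_log (by simpa using h1) (by simpa using h0))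
  simp only [Complex.neg_re, Complex.add_re, Complex.ofReal_re, Complex.mul_re,
    Complex.I_re, mul_zero, Complex.ofReal_im, Complex.I_im, mul_one, sub_self, add_zero,
    Complex.neg_im, Complex.add_im, Complex.mul_im, zero_add, abs_neg] at e2
  have h0 := hE0 t
  have h5 : (0 : ℝ) < 1 + |t| := by positivity
  have hJ0 := setIntegral_rpow_mul_cutLog_nonneg (k + 1) i (-d)
  rw [norm_mul]
  calc _ ≤ (((1 + |t|) ^ N)⁻¹ * (C * ∫ x in Ioi 0, x ^ (-d - 1) * Real.log (1 + x))) *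
        ((1 + |t|) ^ N * E t) := by
        have := hJ0.trans e4
        refine mul_le_mul (e2.trans ?_) e1 (norm_nonneg _) (by positivity)
        gcongr
    _ = _ := by field_simp

/-- The Mellin--Barnes integral of the capacity formula converges absolutely on every line that
separates the poles. -/
theorem IsFoxContour.capacity (hnp : n ≤ p) (hA : ∀ i, 0 < (up i).2) (hB : ∀ i, 0 < (lo i).2)
    {c d : ℝ} (hc : IsFoxContour m n up lo c)
    (hd : SeparatesPoles (m + 2) (n + 1) (capacityUpper up) (capacityLower lo) d) :
    IsFoxContour (m + 2) (n + 1) (capacityUpper up) (capacityLower lo) d := by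
  refine ⟨hd, ?_⟩
  obtain ⟨h0, h1, hd'⟩ := hd.of_capacity hA hB
  obtain ⟨k, hk⟩ := exists_nat_gt |d|
  obtain ⟨E, hE, hb⟩ := hc.exists_bound_cutLog hA hB hd' h0 h1 k hk
  refine hE.mono' (continuous_vertical fun v hv => ?_).aestronglyMeasurable
    (ae_of_all _ fun t => ?_)
  · exact (SeparatesPoles.differentiableAt (capacityUpper_snd_pos hA) (capacityLower_snd_pos hB)
      (by rwa [hv])).continuousAt
  · rw [foxKernel_capacity_eq_mellin_mul hnp _ _ (by simpa using h0) (by simpa using h1)]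
    -- The uniform bound for the cut-offs passes to the pointwise limit.
    exact le_of_tendsto (((tendsto_mellin_cutLog (k + 1) (by simpa using h0)
      (by simpa using h1)).mul_const _).norm) (Eventually.of_forall fun i => hb i t)

theorem IsFoxContour.tendsto_integral_foxH_mul_cutLog (hnp : n ≤ p) (hA : ∀ i, 0 < (up i).2)
    (hB : ∀ i, 0 < (lo i).2) {c d φ : ℝ} (hφ : 0 < φ) (hc : IsFoxContour m n up lo c)
    (hd : SeparatesPoles (m + 2) (n + 1) (capacityUpper up) (capacityLower lo) d)
    {k : ℕ} (hk : |1 - c| < k) (hk' : |d| < k) :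
    Tendsto (fun i => ∫ x in Ioi 0, foxH m n up lo c (φ * x) * (cutLog (k + 1) i x : ℂ)) atTop
      (𝓝 ((φ : ℂ)⁻¹ * foxH (m + 2) (n + 1) (capacityUpper up) (capacityLower lo) d φ)) := by
  obtain ⟨h0, h1, hd'⟩ := hd.of_capacity hA hB
  have hφ0 : (φ : ℂ) ≠ 0 := by exact_mod_cast hφ.ne'
  obtain ⟨E, hE, hb⟩ := hc.exists_bound_cutLog hA hB hd' h0 h1 k hk'
  have e : ∀ i : ℕ, ∫ x in Ioi 0, foxH m n up lo c (φ * x) * (cutLog (k + 1) i x : ℂ) =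
      (1 / (2 * Real.pi) : ℝ) * ∫ t : ℝ, (φ : ℂ)⁻¹ * ((φ : ℂ) ^ (-(d + t * Complex.I)) *
        (mellin (fun x => (cutLog (k + 1) i x : ℂ)) (-(d + t * Complex.I)) *
          foxKernel m n up lo (d + t * Complex.I + 1))) := by
    intro i
    rw [(hc.integral_foxH_mul_cutLog hA hB hφ hd' hk (by simpa using hk') i).2]
    congr 2
    funext t
    rw [show ((d + 1 : ℝ) : ℂ) + t * Complex.I = d + t * Complex.I + 1 by push_cast; ring,
      show (1 - (d + t * Complex.I + 1) : ℂ) = -(d + t * Complex.I) by ring,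
      show (-(d + t * Complex.I + 1) : ℂ) = -(d + t * Complex.I) - 1 by ring,
      Complex.cpow_sub _ _ hφ0, Complex.cpow_one]
    field_simp
  simp only [e]
  have hlim : ∀ t : ℝ, Tendsto (fun i => (φ : ℂ)⁻¹ * ((φ : ℂ) ^ (-(d + t * Complex.I)) *
        (mellin (fun x => (cutLog (k + 1) i x : ℂ)) (-(d + t * Complex.I)) *
          foxKernel m n up lo (d + t * Complex.I + 1)))) atTop
      (𝓝 ((φ : ℂ)⁻¹ * ((φ : ℂ) ^ (-(d + t * Complex.I)) *
        foxKernel (m + 2) (n + 1) (capacityUpper up) (capacityLower lo) (d + t * Complex.I)))) := by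
    intro t
    rw [foxKernel_capacity_eq_mellin_mul hnp _ _ (by simpa using h0) (by simpa using h1)]
    exact (((tendsto_mellin_cutLog (k + 1) (by simpa using h0)
      (by simpa using h1)).mul_const _).const_mul _).const_mul _
  have hfinal : (φ : ℂ)⁻¹ * foxH (m + 2) (n + 1) (capacityUpper up) (capacityLower lo) d φ =
      (1 / (2 * Real.pi) : ℝ) * ∫ t : ℝ, (φ : ℂ)⁻¹ * ((φ : ℂ) ^ (-(d + t * Complex.I)) *
        foxKernel (m + 2) (n + 1) (capacityUpper up) (capacityLower lo) (d + t * Complex.I)) := by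
    rw [integral_const_mul, foxH, mellinInv, Complex.real_smul]
    simp only [smul_eq_mul]
    ring
  rw [hfinal]
  refine Tendsto.const_mul _ (tendsto_integral_of_dominated_convergence
    (fun t => φ⁻¹ * (φ ^ (-d) * E t)) (fun i => ?_) ((hE.const_mul _).const_mul _)
    (fun i => ae_of_all _ fun t => ?_) (ae_of_all _ hlim))
  · refine (continuous_vertical (F := fun v => (φ : ℂ)⁻¹ * ((φ : ℂ) ^ (-v) *
        (mellin (fun x => (cutLog (k + 1) i x : ℂ)) (-v) *
          foxKernel m n up lo (v + 1)))) fun v hv => ?_).aestronglyMeasurable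
    refine DifferentiableAt.continuousAt (𝕜 := ℂ) (.const_mul (.mul ?_ (.mul ?_ ?_)) _)
    · exact DifferentiableAt.const_cpow (by fun_prop) (Or.inl hφ0)
    · exact (differentiableAt_mellin_cutLog i (s := -v) (by simpa [hv] using hk')).fun_comp' v
        (by fun_prop)
    · exact (SeparatesPoles.differentiableAt hA hB (v := v + 1) (by simpa [hv] using hd')).fun_comp'
        v (by fun_prop)
  · rw [norm_mul, norm_mul, norm_inv, Complex.norm_real, Real.norm_of_nonneg hφ.le,
      Complex.norm_cpow_eq_rpow_re_of_pos hφ]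
    have := hb i t
    have hre : (-((d : ℂ) + t * Complex.I)).re = -d := by simp
    rw [hre]
    gcongr

end Capacity

/-! ### Monotone convergence and the density of the SINR -/

/-- Monotone convergence, including integrability of the limit. -/
theorem integrableOn_and_integral_eq_of_monotone {s : Set ℝ} (hs : MeasurableSet s)
    {u : ℕ → ℝ → ℝ} {U : ℝ → ℝ} {S : ℝ} (hu : ∀ i, IntegrableOn (u i) s)
    (h0 : ∀ i, ∀ x ∈ s, 0 ≤ u i x) (hmono : ∀ x ∈ s, Monotone fun i => u i x)
    (hlim : ∀ x ∈ s, Tendsto (fun i => u i x) atTop (𝓝 (U x)))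
    (hS : Tendsto (fun i => ∫ x in s, u i x) atTop (𝓝 S)) :
    IntegrableOn U s ∧ ∫ x in s, U x = S := by
  have hm : AEStronglyMeasurable U (volume.restrict s) :=
    aestronglyMeasurable_of_tendsto_ae atTop (fun i => (hu i).aestronglyMeasurable)
      ((ae_restrict_mem hs).mono hlim)
  have hU0 : 0 ≤ᵐ[volume.restrict s] U := (ae_restrict_mem hs).mono fun x hx =>
    ge_of_tendsto' (hlim x hx) fun i => h0 i x hx
  have h1 : Tendsto (fun i => ∫⁻ x in s, ENNReal.ofReal (u i x)) atTop
      (𝓝 (∫⁻ x in s, ENNReal.ofReal (U x))) := by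
    refine lintegral_tendsto_of_tendsto_of_monotone (fun i => (hu i).aemeasurable.ennreal_ofReal)
      ?_ ?_
    · exact (ae_restrict_mem hs).mono fun x hx i j hij =>
        ENNReal.ofReal_le_ofReal (hmono x hx hij)
    · exact (ae_restrict_mem hs).mono fun x hx =>
        (ENNReal.continuous_ofReal.tendsto _).comp (hlim x hx)
  have h2 : Tendsto (fun i => ∫⁻ x in s, ENNReal.ofReal (u i x)) atTop (𝓝 (ENNReal.ofReal S)) := by
    refine ((ENNReal.continuous_ofReal.tendsto _).comp hS).congr fun i => ?_
    exact ofReal_integral_eq_lintegral_ofReal (hu i) ((ae_restrict_mem hs).mono (h0 i))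
  have hint : IntegrableOn U s := by
    refine ⟨hm, ?_⟩
    rw [hasFiniteIntegral_iff_ofReal hU0, tendsto_nhds_unique h1 h2]
    exact ENNReal.ofReal_lt_top
  exact ⟨hint, tendsto_nhds_unique (integral_tendsto_of_tendsto_of_monotone hu hint
    ((ae_restrict_mem hs).mono hmono) ((ae_restrict_mem hs).mono hlim)) hS⟩

section Density

variable {Ω : Type*} [MeasurableSpace Ω] {P : Measure Ω} [IsProbabilityMeasure P]

theorem IsPositivePDF.integrableOn {X : Ω → ℝ} {f : ℝ → ℝ} (h : IsPositivePDF P X f)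
    (hf : ContinuousOn f (Ioi 0)) : IntegrableOn f (Ioi 0) := by
  refine ⟨hf.aestronglyMeasurable measurableSet_Ioi, ?_⟩
  rw [hasFiniteIntegral_iff_ofReal ((ae_restrict_mem measurableSet_Ioi).mono h.nonneg)]
  have h1 := congrArg (fun μ : Measure ℝ => μ univ) h.map_eq
  have := Measure.isProbabilityMeasure_map h.aemeasurable
  simp only [measure_univ, withDensity_apply _ MeasurableSet.univ, Measure.restrict_univ] at h1
  rw [← h1]
  exact ENNReal.one_lt_top

theorem IsPositivePDF.cdf_eq {X : Ω → ℝ} {f : ℝ → ℝ} (h : IsPositivePDF P X f)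
    (hf : ContinuousOn f (Ioi 0)) {x : ℝ} (hx : 0 < x) :
    ProbabilityTheory.cdf (P.map X) x = ∫ y in (0 : ℝ)..x, f y := by
  have := Measure.isProbabilityMeasure_map h.aemeasurable
  have hsub : Ioc 0 x ⊆ Ioi 0 := fun y hy => hy.1
  rw [ProbabilityTheory.cdf_eq_real, Measure.real, h.map_eq, withDensity_apply _ measurableSet_Iic,
    Measure.restrict_restrict measurableSet_Iic, inter_comm, Ioi_inter_Iic,
    intervalIntegral.integral_of_le hx.le, ← ofReal_integral_eq_lintegral_ofReal
      ((h.integrableOn hf).mono_set hsub)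
      ((ae_restrict_mem measurableSet_Ioc).mono fun y hy => h.nonneg y hy.1),
    ENNReal.toReal_ofReal]
  exact setIntegral_nonneg measurableSet_Ioc fun y hy => h.nonneg y hy.1

theorem IsPositivePDF.deriv_sinrCDF {X : Ω → ℝ} {f : ℝ → ℝ} (h : IsPositivePDF P X f)
    (hf : ContinuousOn f (Ioi 0)) {x : ℝ} (hx : 0 < x) :
    deriv (sinrCDF P X 1 0 1) x = f x := by
  have e : sinrCDF P X 1 0 1 =ᶠ[𝓝 x] fun z => ∫ y in (0 : ℝ)..z, f y := by
    filter_upwards [lt_mem_nhds hx] with z hz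
    rw [← h.cdf_eq hf hz]
    -- 1 / (0 + 1 / y) = y holds for every real y, including y = 0 by the convention for division by
    -- zero.
    simp [sinrCDF, sinr]
  rw [e.deriv_eq]
  refine (intervalIntegral.integral_hasDerivAt_right ?_ ?_ (hf.continuousAt (Ioi_mem_nhds hx))).deriv
  · rw [intervalIntegrable_iff_integrableOn_Ioc_of_le hx.le]
    exact (h.integrableOn hf).mono_set fun y hy => hy.1
  · exact hf.stronglyMeasurableAtFilter isOpen_Ioi x hx

end Density

theorem sinrRange_one_zero : sinrRange 1 0 = Ioi 0 := by
  ext x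
  simp [sinrRange]

end FoxHFading

/-! ### The capacity formula -/

theorem corollary1 {Ω : Type*} [MeasurableSpace Ω] (P : MeasureTheory.Measure Ω)
    [MeasureTheory.IsProbabilityMeasure P] (γid : Ω → ℝ)
    (L m n p q : ℕ) (hmq : m ≤ q) (hnp : n ≤ p)
    -- positive weights and scales, real `a`, `b` and positive `A`, `B`
    (ψ φ : Fin L → ℝ) (hψ : ∀ l, 0 < ψ l) (hφ : ∀ l, 0 < φ l)
    (up : Fin L → Fin p → ℝ × ℝ) (lo : Fin L → Fin q → ℝ × ℝ)
    (hA : ∀ l i, 0 < (up l i).2) (hB : ∀ l i, 0 < (lo l i).2)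
    -- the contours of the density, and the density of the ideal SNR
    (c : Fin L → ℝ) (hc : ∀ l, FoxHFading.IsFoxContour m n (up l) (lo l) (c l))
    (f : ℝ → ℝ)
    (hf : ∀ x, 0 < x →
      (f x : ℂ) = ∑ l, (ψ l : ℂ) * FoxHFading.foxH m n (up l) (lo l) (c l) (φ l * x))
    (hpdf : FoxHFading.IsPositivePDF P γid f) :
    -- if all `b_i + B_i` are positive (`i ≤ m`) and all `a_i + A_i` are below `1` (`i ≤ n`), then
    -- there are contours for the Fox functions of the capacity formula
    ((∀ l, (∀ i : Fin q, i.val < m → 0 < (lo l i).1 + (lo l i).2) ∧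
        ∀ i : Fin p, i.val < n → (up l i).1 + (up l i).2 < 1) →
      ∃ d : Fin L → ℝ, ∀ l, FoxHFading.IsFoxContour (m + 2) (n + 1)
        (FoxHFading.capacityUpper (up l)) (FoxHFading.capacityLower (lo l)) (d l)) ∧
    -- on any lines that separate the poles the formula holds, with convergent integrals
    ∀ d : Fin L → ℝ,
      (∀ l, FoxHFading.SeparatesPoles (m + 2) (n + 1) (FoxHFading.capacityUpper (up l))
        (FoxHFading.capacityLower (lo l)) (d l)) →
      (∀ l, FoxHFading.IsFoxContour (m + 2) (n + 1) (FoxHFading.capacityUpper (up l))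
        (FoxHFading.capacityLower (lo l)) (d l)) ∧
      MeasureTheory.IntegrableOn (FoxHFading.capacityIntegrand P γid 1 0 1)
        (FoxHFading.sinrRange 1 0) ∧
      (FoxHFading.oraCapacity P γid 1 0 1 : ℂ) =
        1 / (Real.log 2 : ℂ) * ∑ l, (ψ l / φ l : ℂ) *
          FoxHFading.foxH (m + 2) (n + 1) (FoxHFading.capacityUpper (up l))
            (FoxHFading.capacityLower (lo l)) (d l) (φ l) := by
  have hcontH : ∀ l, ContinuousOn
      (fun x => FoxHFading.foxH m n (up l) (lo l) (c l) (φ l * x)) (Set.Ioi 0) := fun l =>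
    (FoxHFading.continuousOn_mellinInv (hc l).converges).comp (by fun_prop) fun x hx =>
      mul_pos (hφ l) hx
  have hcont : ContinuousOn f (Set.Ioi 0) := by
    have h1 : ContinuousOn (fun x => (f x : ℂ)) (Set.Ioi 0) :=
      (continuousOn_finsetSum (s := Finset.univ)
        (f := fun l x => (ψ l : ℂ) * FoxHFading.foxH m n (up l) (lo l) (c l) (φ l * x))
        fun l _ => (hcontH l).const_smul (ψ l : ℂ)).congr fun x hx => hf x hx
    exact Complex.continuous_re.comp_continuousOn h1
  have hcontour : ∀ d : Fin L → ℝ, (∀ l, FoxHFading.SeparatesPoles (m + 2) (n + 1)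
      (FoxHFading.capacityUpper (up l)) (FoxHFading.capacityLower (lo l)) (d l)) →
      ∀ l, FoxHFading.IsFoxContour (m + 2) (n + 1) (FoxHFading.capacityUpper (up l))
        (FoxHFading.capacityLower (lo l)) (d l) := fun d hd l =>
    (hc l).capacity hnp (hA l) (hB l) (hd l)
  refine ⟨fun h => ?_, fun d hd => ⟨hcontour d hd, ?_⟩⟩
  · choose d hd using fun l => FoxHFading.exists_separatesPoles_capacity hnp (hA l) (hB l)
      (h l).1 (h l).2
    exact ⟨d, hcontour d hd⟩
  obtain ⟨k, hk⟩ : ∃ k : ℕ, ∀ l, |1 - c l| < k ∧ |d l| < k := by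
    have : ∀ᶠ k : ℕ in Filter.atTop, ∀ l, |1 - c l| < k ∧ |d l| < k :=
      Filter.eventually_all.2 fun l =>
        (tendsto_natCast_atTop_atTop.eventually_gt_atTop _).and
          (tendsto_natCast_atTop_atTop.eventually_gt_atTop _)
    exact this.exists
  set S : ℂ := ∑ l, (ψ l / φ l : ℂ) * FoxHFading.foxH (m + 2) (n + 1)
    (FoxHFading.capacityUpper (up l)) (FoxHFading.capacityLower (lo l)) (d l) (φ l) with hS
  have hterm : ∀ i l, IntegrableOn (fun x => (ψ l : ℂ) *
      (FoxHFading.foxH m n (up l) (lo l) (c l) (φ l * x) *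
        (FoxHFading.cutLog (k + 1) i x : ℂ))) (Set.Ioi 0) := fun i l =>
    ((hc l).integral_foxH_mul_cutLog (hA l) (hB l) (hφ l) ((hd l).of_capacity (hA l) (hB l)).2.2
      (hk l).1 (by simpa using (hk l).2) i).1.const_mul _
  have heq : ∀ i, ∀ x ∈ Set.Ioi (0 : ℝ), ((FoxHFading.cutLog (k + 1) i x * f x : ℝ) : ℂ) =
      ∑ l, (ψ l : ℂ) * (FoxHFading.foxH m n (up l) (lo l) (c l) (φ l * x) *
        (FoxHFading.cutLog (k + 1) i x : ℂ)) := by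
    intro i x hx
    rw [Complex.ofReal_mul, hf x hx, mul_comm, Finset.sum_mul]
    simp only [mul_assoc]
  have hint : ∀ i, IntegrableOn (fun x => FoxHFading.cutLog (k + 1) i x * f x) (Set.Ioi 0) := by
    intro i
    have h1 : IntegrableOn (fun x => ((FoxHFading.cutLog (k + 1) i x * f x : ℝ) : ℂ))
        (Set.Ioi 0) :=
      (integrableOn_congr_fun (heq i) measurableSet_Ioi).2
        (integrable_finsetSum _ fun l _ => hterm i l)
    exact h1.re
  have hval : ∀ i, ((∫ x in Set.Ioi 0, FoxHFading.cutLog (k + 1) i x * f x : ℝ) : ℂ) =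
      ∑ l, (ψ l : ℂ) * ∫ x in Set.Ioi 0, FoxHFading.foxH m n (up l) (lo l) (c l) (φ l * x) *
        (FoxHFading.cutLog (k + 1) i x : ℂ) := by
    intro i
    rw [← integral_complex_ofReal, setIntegral_congr_fun measurableSet_Ioi (heq i),
      integral_finsetSum _ fun l _ => hterm i l]
    simp only [integral_const_mul]
  have hlim : Filter.Tendsto (fun i => ((∫ x in Set.Ioi 0,
      FoxHFading.cutLog (k + 1) i x * f x : ℝ) : ℂ)) Filter.atTop (nhds S) := by
    simp only [hval]
    refine tendsto_finsetSum _ fun l _ => ?_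
    rw [div_eq_mul_inv, mul_assoc]
    exact ((hc l).tendsto_integral_foxH_mul_cutLog hnp (hA l) (hB l) (hφ l) (hd l) (hk l).1
      (hk l).2).const_mul _
  have hre := (Complex.continuous_re.tendsto S).comp hlim
  have him := (Complex.continuous_im.tendsto S).comp hlim
  -- S is a limit of real integrals, hence real.
  have hSre : (S.re : ℂ) = S := by
    refine Complex.ext (by simp) ?_
    rw [Complex.ofReal_im]
    exact tendsto_nhds_unique (tendsto_const_nhds.congr fun i => by simp) him
  -- Monotone convergence is applied to the whole density: the separate Fox functions need not be
  -- nonnegative.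
  have hmain := FoxHFading.integrableOn_and_integral_eq_of_monotone measurableSet_Ioi hint
    (fun i x hx => mul_nonneg (FoxHFading.cutLog_nonneg _ i hx) (hpdf.nonneg x hx))
    (fun x hx i j hij => mul_le_mul_of_nonneg_right (FoxHFading.cutLog_monotone (k + 1) hx hij)
      (hpdf.nonneg x hx))
    (fun x hx => (FoxHFading.tendsto_cutLog (k + 1) hx).mul_const (f x)) hre
  have hcap : Set.EqOn (FoxHFading.capacityIntegrand P γid 1 0 1)
      (fun x => Real.log (1 + x) * f x) (Set.Ioi 0) := fun x hx => by
    simp only [FoxHFading.capacityIntegrand]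
    rw [hpdf.deriv_sinrCDF hcont hx]
  rw [FoxHFading.oraCapacity, FoxHFading.sinrRange_one_zero]
  refine ⟨(integrableOn_congr_fun hcap measurableSet_Ioi).2 hmain.1, ?_⟩
  rw [setIntegral_congr_fun measurableSet_Ioi hcap, hmain.2, Complex.ofReal_mul, hSre]
  simp
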